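/- **Setting.** Data values are Booleans, integers, reals, probability distributions on real vector spaces, pairs and lists of data values, and possibly further ground values; $\bot$ is the undefined value, and a function symbol denotes a total operation on data values and $\bot$. Fix $l\in\mathbb N$; a dataset is a list of vectors of $\mathbb R^l$. There are finitely many observable variables, finitely many hypothesis tests $A$ (each with a test statistic $T_A$, a law $D_A$ of the statistic under the null hypothesis, and a relation "at most as likely as" on its values), and finitely many invisible variables, among them a history variable $h_{y,A}$ for every observable $y$ and every test $A$. The function symbols comprise Boolean, integer and rational constants, integer addition, comparison of integers and of reals, length and $n$-th entry of lists, a conditional, a symbol $f_A$ for every test (whose value on a dataset $d$ is the $p$-value $\Pr_{t\sim D_A}[t \text{ at most as likely as } T_A(d)]$, undefined on non-datasets), and arbitrary further symbols with an arbitrary interpretation. *Programs* are $C ::= \mathtt{skip}\mid v:=e\mid C;C\mid C\,\|\,C\mid \mathtt{if}\ e\ \mathtt{then}\ C\ \mathtt{else}\ C\mid \mathtt{loop}\ e\ \mathtt{do}\ C$ over observable variables; in every $C_1\|C_2$, neither component updates a variable occurring in the other. A *state* is $(m,a,H)$: an assignment, the last action (a command, or a sampling $d\sim D^n$; none in an initial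 state), and a test history $H$ mapping each dataset to the multiset of tests applied to it. A *world* $w$ is a non-empty finite sequence of states, its last state being the current one. Programs have the standard small-step semantics (interleaving for $\|$): each command appends a new state recording the command, and $v:=f_A(y)$, executable when $y$ holds a dataset $d$, moreover increases $h_{y,A}$ by $1$ and adds $A$ to $H(d)$. A guard that is neither true nor false blocks. $[\![C]\!](w)$ is the set of final worlds of the executions of $C$ from $w$. A *Kripke model* $\mathfrak M$ has a non-empty set $\mathcal W$ of worlds such that initial states have empty history and all $h_{y,A}=0$; every further state arises from the preceding one by its recorded action, the preceding world being again in $\mathcal W$ (samplings change neither $H$ nor any $h_{y,A}$); and $\mathcal W$ is closed under execution of commands. Two worlds are indistinguishable if they agree, state by state, on the values of observable variables, the actions and the histories. *ELHT formulas*: quantifier-free formulas are built by $\neg$, $\wedge$ and the knowledge modality $\mathbf K$ (truth in all indistinguishable worlds of $\mathcal W$) from atoms: $u=u'$ (both sides defined and equal); "$d$ consists of $n$ data sampled from $D$" and "$d$ was sampled from $D$" (the sampling is recorded in the world); $\tau^{\bowtie}_{y,A}(\epsilon)$ ($y$ holds a dataset, $\epsilon\in[0,1]$, and the $p$-value of $A$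 on $y$ is $\bowtie\epsilon$, for $\bowtie\,\in\{=,\le,\ge,<,>\}$); and further predicates whose valuation in a world is not affected by executing commands. Terms may contain all variables and integer variables $i$, which an interpretation $\mathcal I$ maps to finite tuples of integers. Formulas are built from quantifier-free ones by $\neg$, $\wedge$ and $\forall i$ over finite integer tuples, so that no quantifier occurs inside $\mathbf K$. **Proposition (Expressiveness).** Fix the interpretation of the function symbols and the hypothesis tests. Let $C$ be a program and $\phi$ an ELHT formula. If $C$ contains a loop, assume that its data are encodable by integer tuples: there is a term $\delta(t,\bar x)$, with $\bar x$ the observable variables, such that for all values of $\bar x$, every value obtained from them by the operations of the function symbols occurring in $C$ equals $\delta(t,\bar x)$ for some finite tuple $t$ of integers. Then there is an ELHT formula $F$ such that, for every Kripke model $\mathfrak M$ and every interpretation $\mathcal I$ of the integer variables, its extension is the weakest precondition of $\phi$: $$\{w\in\mathcal W\mid w\models^{\mathcal I}F\}=\{w\in\mathcal W\mid w'\models^{\mathcal I}\phi\text{ for all }w'\in[\![C]\!](w)\}.$$ -/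

import Mathlib

noncomputable section

namespace BHL

/-! ## Vocabulary and data values -/

/-- The non-logical vocabulary: the dimension `dim` of the population space `ℝ ^ dim`, the
observable and the (non-history) invisible variables, the names of the hypothesis tests under
consideration, and the function and predicate symbols that are not built in. -/
structure Vocab where
  dim : ℕ
  /-- further ground data values (for instance distributions over other kinds of data) -/
  Other : Type
  Obs : Type
  Inv : Type
  Test : Type
  Fn : Type
  fnArity : Fn → ℕ
  Rel : Type
  relArity : Rel → ℕ
  finObs : Finite Obs
  finInv : Finite Inv
  finTest : Finite Test

/-- Data values: Booleans, integers, reals, distributions, pairs and lists. -/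
inductive Data (Other : Type) : Type
  | bool (b : Bool)
  | int (z : ℤ)
  | real (r : ℝ)
  | dist (k : ℕ) (μ : MeasureTheory.ProbabilityMeasure (Fin k → ℝ))
  | pair (a b : Data Other)
  | list (xs : List (Data Other))
  | other (x : Other)

variable (S : Vocab)

/-- Values of variables and terms; `none` is the undefined value `⊥`. -/
abbrev Val : Type := Option (Data S.Other)

/-- Distributions over the population space. -/
abbrev Pop : Type := MeasureTheory.ProbabilityMeasure (Fin S.dim → ℝ)

/-- Datasets: lists of real vectors. -/
abbrev Dataset : Type := List (Fin S.dim → ℝ)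

/-- All variables: observable ones, invisible ones, and the (invisible) history variables
`h_{y,A}`. -/
inductive Var : Type
  | obs (x : S.Obs)
  | inv (z : S.Inv)
  | hist (y : S.Obs) (A : S.Test)

/-- Function symbols: Boolean, integer and rational constants, integer addition, comparison,
length and `n`-th element of a list, conditional, the symbols `f_A` of the hypothesis tests, and
the further symbols of the vocabulary. -/
inductive Sym : Type
  | boolLit (b : Bool)
  | intLit (z : ℤ)
  | realLit (q : ℚ)
  | add
  | le
  | len
  | nth
  | cond
  | test (A : S.Test)
  | fn (f : S.Fn)

/-- The arity of a function symbol. -/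
def Sym.arity {S : Vocab} : Sym S → ℕ
  | .boolLit _ => 0
  | .intLit _ => 0
  | .realLit _ => 0
  | .add => 2
  | .le => 2
  | .len => 1
  | .nth => 2
  | .cond => 3
  | .test _ => 1
  | .fn f => S.fnArity f

/-- Terms over a type `V` of variables. -/
inductive Term (V : Type) : Type
  | var (v : V)
  | app (f : Sym S) (args : Fin f.arity → Term V)

/-- Program terms only contain observable variables. -/
abbrev PTerm : Type := Term S S.Obs

/-- Integer variables (denoting finite tuples of integers). -/
abbrev IntVar : Type := ℕ

/-- Assertion terms contain all variables and integer variables. -/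
abbrev ATerm : Type := Term S (Var S ⊕ IntVar)

/-! ## Programs -/

/-- Commands. -/
inductive Cmd : Type
  | skip
  | assign (v : S.Obs) (e : PTerm S)

/-- Programs, before the side condition on parallel compositions. -/
inductive Prog : Type
  | cmd (c : Cmd S)
  | seq (C₁ C₂ : Prog)
  | par (C₁ C₂ : Prog)
  | cond (e : PTerm S) (C₁ C₂ : Prog)
  | loop (e : PTerm S) (C : Prog)

variable {S}

/-- The term `f_A(y)`. -/
def testTerm (A : S.Test) (y : S.Obs) : PTerm S := .app (.test A) (fun _ => .var y)

/-- The variables of a term. -/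
def Term.vars {V : Type} : Term S V → Set V
  | .var v => {v}
  | .app _ args => ⋃ j, (args j).vars

/-- The function symbols of a term. -/
def Term.syms {V : Type} : Term S V → Set (Sym S)
  | .var _ => ∅
  | .app f args => {f} ∪ ⋃ j, (args j).syms

def Cmd.upd : Cmd S → Set S.Obs
  | .skip => ∅
  | .assign v _ => {v}

def Cmd.vars : Cmd S → Set S.Obs
  | .skip => ∅
  | .assign v e => {v} ∪ e.vars

def Cmd.syms : Cmd S → Set (Sym S)
  | .skip => ∅
  | .assign _ e => e.syms

/-- The variables that may be updated by a program. -/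
def Prog.upd : Prog S → Set S.Obs
  | .cmd c => c.upd
  | .seq C₁ C₂ => C₁.upd ∪ C₂.upd
  | .par C₁ C₂ => C₁.upd ∪ C₂.upd
  | .cond _ C₁ C₂ => C₁.upd ∪ C₂.upd
  | .loop _ C => C.upd

/-- The variables occurring in a program. -/
def Prog.vars : Prog S → Set S.Obs
  | .cmd c => c.vars
  | .seq C₁ C₂ => C₁.vars ∪ C₂.vars
  | .par C₁ C₂ => C₁.vars ∪ C₂.vars
  | .cond e C₁ C₂ => e.vars ∪ C₁.vars ∪ C₂.vars
  | .loop e C => e.vars ∪ C.vars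

/-- The function symbols occurring in a program. -/
def Prog.syms : Prog S → Set (Sym S)
  | .cmd c => c.syms
  | .seq C₁ C₂ => C₁.syms ∪ C₂.syms
  | .par C₁ C₂ => C₁.syms ∪ C₂.syms
  | .cond e C₁ C₂ => e.syms ∪ C₁.syms ∪ C₂.syms
  | .loop e C => e.syms ∪ C.syms

/-- Well-formed programs: in every parallel composition, neither component updates a variable
of the other one. -/
def Prog.WF : Prog S → Prop
  | .cmd _ => True
  | .seq C₁ C₂ => C₁.WF ∧ C₂.WF
  | .par C₁ C₂ => C₁.WF ∧ C₂.WF ∧ C₁.upd ∩ C₂.vars = ∅ ∧ C₂.upd ∩ C₁.vars = ∅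
  | .cond _ C₁ C₂ => C₁.WF ∧ C₂.WF
  | .loop _ C => C.WF

/-- The program contains a loop. -/
def Prog.HasLoop : Prog S → Prop
  | .cmd _ => False
  | .seq C₁ C₂ => C₁.HasLoop ∨ C₂.HasLoop
  | .par C₁ C₂ => C₁.HasLoop ∨ C₂.HasLoop
  | .cond _ C₁ C₂ => C₁.HasLoop ∨ C₂.HasLoop
  | .loop _ _ => True

/-! ## Syntax of the assertion language -/

/-- The comparisons `=, ≤, ≥, <, >`. -/
inductive Cmp : Type
  | eq | le | ge | lt | gt

def Cmp.holds : Cmp → ℝ → ℝ → Prop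
  | .eq, a, b => a = b
  | .le, a, b => a ≤ b
  | .ge, a, b => a ≥ b
  | .lt, a, b => a < b
  | .gt, a, b => a > b

variable (S)

/-- Quantifier-free formulas: atomic formulas, negation, conjunction and the knowledge modality.
`sampledN d D n` says that `d` consists of `n` data sampled from `D`, `sampled d D` that `d` has
been sampled from `D`, and `tau r y A ε` that the `p`-value of the test `A` on the dataset `y`
is in the relation `r` to `ε`. -/
inductive BaseFml : Type
  | eq (u v : ATerm S)
  | sampledN (d D n : ATerm S)
  | sampled (d D : ATerm S)
  | tau (r : Cmp) (y : Var S) (A : S.Test) (ε : ATerm S)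
  | rel (R : S.Rel) (args : Fin (S.relArity R) → ATerm S)
  | neg (φ : BaseFml)
  | and (φ ψ : BaseFml)
  | know (φ : BaseFml)

/-- Formulas: quantification over integer variables, never inside the knowledge modality. -/
inductive Fml : Type
  | base (φ : BaseFml S)
  | neg (φ : Fml)
  | and (φ ψ : Fml)
  | all (i : IntVar) (φ : Fml)

/-- Hypothesis tests: the null hypothesis, the test statistic, its distribution under the null
hypothesis, the likeliness relation, and a term denoting the population with its unknown and
known parameters. -/
structure HypTest where
  null : Fml S
  range : ℕ
  stat : Dataset S → (Fin range → ℝ)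
  law : MeasureTheory.ProbabilityMeasure (Fin range → ℝ)
  unlikely : (Fin range → ℝ) → (Fin range → ℝ) → Prop
  measurable_unlikely : ∀ t', MeasurableSet {t | unlikely t t'}
  population : ATerm S

variable {S} in
/-- The `p`-value of a dataset: the probability that a value is at most as likely as the test
statistic. -/
def HypTest.pValue (A : HypTest S) (d : Dataset S) : ℝ :=
  ((A.law : MeasureTheory.Measure (Fin A.range → ℝ)) {t | A.unlikely t (A.stat d)}).toReal

/-- The meaning of the vocabulary: the hypothesis tests, and the operations denoted by the
function symbols that are not built in. -/
structure Interp where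
  test : S.Test → HypTest S
  fn : (f : S.Fn) → (Fin (S.fnArity f) → Val S) → Val S

variable {S}

/-! ## Semantics of terms -/

/-- A dataset as a data value: a list of lists of reals. -/
def ofDataset (d : Dataset S) : Data S.Other :=
  .list (d.map fun v => .list (List.ofFn fun j => .real (v j)))

/-- A tuple of integers as a data value. -/
def ofTuple (t : List ℤ) : Data S.Other := .list (t.map .int)

def addVal : Val S → Val S → Val S
  | some (.int a), some (.int b) => some (.int (a + b))
  | _, _ => none

open Classical in
def leVal : Val S → Val S → Val S
  | some (.int a), some (.int b) => some (.bool (decide (a ≤ b)))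
  | some (.real a), some (.real b) => some (.bool (decide (a ≤ b)))
  | _, _ => none

def lenVal : Val S → Val S
  | some (.list xs) => some (.int xs.length)
  | _ => none

/-- The `z`-th element of a list, counted from `0`; undefined if there is none. -/
def nthVal : Val S → Val S → Val S
  | some (.list xs), some (.int z) => if 0 ≤ z then xs[z.toNat]? else none
  | _, _ => none

def condVal : Val S → Val S → Val S → Val S
  | some (.bool b), u, v => if b then u else v
  | _, _, _ => none

open Classical in
/-- The value of `f_A`: the `p`-value, undefined on everything that is not a dataset. -/
def Interp.testVal (J : Interp S) (A : S.Test) (o : Val S) : Val S :=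
  if h : ∃ d : Dataset S, o = some (ofDataset d) then
    some (.real ((J.test A).pValue h.choose))
  else none

/-- The operation denoted by a function symbol. -/
def Interp.sym (J : Interp S) : (f : Sym S) → (Fin f.arity → Val S) → Val S
  | .boolLit b => fun _ => some (.bool b)
  | .intLit z => fun _ => some (.int z)
  | .realLit q => fun _ => some (.real q)
  | .add => fun a => addVal (a (0 : Fin 2)) (a (1 : Fin 2))
  | .le => fun a => leVal (a (0 : Fin 2)) (a (1 : Fin 2))
  | .len => fun a => lenVal (a (0 : Fin 1))
  | .nth => fun a => nthVal (a (0 : Fin 2)) (a (1 : Fin 2))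
  | .cond => fun a => condVal (a (0 : Fin 3)) (a (1 : Fin 3)) (a (2 : Fin 3))
  | .test A => fun a => J.testVal A (a (0 : Fin 1))
  | .fn f => J.fn f

/-- The value of a term under an assignment of values to its variables. -/
def Term.eval (J : Interp S) {V : Type} (ρ : V → Val S) : Term S V → Val S
  | .var v => ρ v
  | .app f args => J.sym f (fun j => (args j).eval J ρ)

/-! ## States, worlds, observations -/

variable (S)

/-- Assignments. -/
abbrev Mem : Type := Var S → Val S

/-- Test histories. -/
abbrev Hist : Type := Dataset S → Multiset S.Test

/-- Actions: program commands, and samplings `d ∼ D ^ n`. -/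
inductive Act : Type
  | cmd (c : Cmd S)
  | smpl (d : Dataset S) (D : Pop S) (n : ℕ)

/-- States: the current assignment, the action of the last transition (`none` if there was no
transition yet), and the test history. -/
structure State where
  mem : Mem S
  act : Option (Act S)
  hist : Hist S

/-- Non-empty sequences of states: the current state, and the earlier ones, latest first. -/
structure World where
  cur : State S
  past : List (State S)

variable {S}

/-- The world `w; s`. -/
def World.push (w : World S) (s : State S) : World S := ⟨s, w.cur :: w.past⟩

def World.states (w : World S) : List (State S) := w.cur :: w.past

/-- The observation of a state: the values of the observable variables, the action and the test
history. -/
def State.observe (s : State S) : (S.Obs → Val S) × Option (Act S) × Hist S :=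
  (fun x => s.mem (.obs x), s.act, s.hist)

def World.observe (w : World S) : List ((S.Obs → Val S) × Option (Act S) × Hist S) :=
  w.states.map State.observe

/-! ## Semantics of programs -/

/-- The value of a program term. -/
def evalP (J : Interp S) (m : Mem S) (e : PTerm S) : Val S := e.eval J (fun x => m (.obs x))

open Classical in
/-- The assignment `m[v ↦ o]`. -/
def setMem (m : Mem S) (v : Var S) (o : Val S) : Mem S := Function.update m v o

open Classical in
/-- Adding a test `A` to the tests that have used the dataset `d`. -/
def Hist.record (H : Hist S) (d : Dataset S) (A : S.Test) : Hist S :=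
  fun o => if o = d then A ::ₘ H o else H o

/-- `CmdStep J c s s'`: executing `c` in the state `s` leads to the new state `s'`. The execution
of a hypothesis test also updates the test history and the history variable. -/
inductive CmdStep (J : Interp S) : Cmd S → State S → State S → Prop
  | skip (s : State S) : CmdStep J .skip s ⟨s.mem, some (.cmd .skip), s.hist⟩
  | assign (s : State S) (v : S.Obs) (e : PTerm S) (he : ∀ A y, e ≠ testTerm A y) :
      CmdStep J (.assign v e) s
        ⟨setMem s.mem (.obs v) (evalP J s.mem e), some (.cmd (.assign v e)), s.hist⟩
  | test (s : State S) (v : S.Obs) (A : S.Test) (y : S.Obs) (d : Dataset S)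
      (hd : s.mem (.obs y) = some (ofDataset d)) :
      CmdStep J (.assign v (testTerm A y)) s
        ⟨setMem (setMem s.mem (.obs v) (evalP J s.mem (testTerm A y))) (.hist y A)
            (addVal (s.mem (.hist y A)) (some (.int 1))),
          some (.cmd (.assign v (testTerm A y))), Hist.record s.hist d A⟩

variable (S) in
/-- Configurations: a program still to be run in a world, or a final world. -/
inductive Conf : Type
  | run (C : Prog S) (w : World S)
  | done (w : World S)

/-- One step of execution. -/
inductive Step (J : Interp S) : Conf S → Conf S → Prop
  | cmd {c : Cmd S} {w : World S} {s : State S} :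
      CmdStep J c w.cur s → Step J (.run (.cmd c) w) (.done (w.push s))
  | seqDone {C₁ C₂ : Prog S} {w w' : World S} :
      Step J (.run C₁ w) (.done w') → Step J (.run (.seq C₁ C₂) w) (.run C₂ w')
  | seqRun {C₁ C₂ C₁' : Prog S} {w w' : World S} :
      Step J (.run C₁ w) (.run C₁' w') → Step J (.run (.seq C₁ C₂) w) (.run (.seq C₁' C₂) w')
  | condTrue {e : PTerm S} {C₁ C₂ : Prog S} {w : World S} :
      evalP J w.cur.mem e = some (.bool true) → Step J (.run (.cond e C₁ C₂) w) (.run C₁ w)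
  | condFalse {e : PTerm S} {C₁ C₂ : Prog S} {w : World S} :
      evalP J w.cur.mem e = some (.bool false) → Step J (.run (.cond e C₁ C₂) w) (.run C₂ w)
  | loopTrue {e : PTerm S} {C : Prog S} {w : World S} :
      evalP J w.cur.mem e = some (.bool true) →
      Step J (.run (.loop e C) w) (.run (.seq C (.loop e C)) w)
  | loopFalse {e : PTerm S} {C : Prog S} {w : World S} :
      evalP J w.cur.mem e = some (.bool false) → Step J (.run (.loop e C) w) (.done w)
  | parLeftRun {C₁ C₂ C₁' : Prog S} {w w' : World S} :
      Step J (.run C₁ w) (.run C₁' w') → Step J (.run (.par C₁ C₂) w) (.run (.par C₁' C₂) w')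
  | parLeftDone {C₁ C₂ : Prog S} {w w' : World S} :
      Step J (.run C₁ w) (.done w') → Step J (.run (.par C₁ C₂) w) (.run C₂ w')
  | parRightRun {C₁ C₂ C₂' : Prog S} {w w' : World S} :
      Step J (.run C₂ w) (.run C₂' w') → Step J (.run (.par C₁ C₂) w) (.run (.par C₁ C₂') w')
  | parRightDone {C₁ C₂ : Prog S} {w w' : World S} :
      Step J (.run C₂ w) (.done w') → Step J (.run (.par C₁ C₂) w) (.run C₁ w')

/-- The set `⟦C⟧(w)` of the final worlds of the executions of `C` from `w`. -/
def Prog.sem (J : Interp S) (C : Prog S) (w : World S) : Set (World S) :=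
  {w' | Relation.TransGen (Step J) (.run C w) (.done w')}

/-! ## Kripke models -/

/-- `Trans J a s s'`: the state `s'` may come after `s` by the action `a`. A sampling may change
the values of variables, but not the test history and the history variables. -/
def Trans (J : Interp S) : Act S → State S → State S → Prop
  | .cmd c, s, s' => CmdStep J c s s'
  | .smpl d D n, s, s' => d.length = n ∧ s'.act = some (.smpl d D n) ∧ s'.hist = s.hist ∧
      ∀ y A, s'.mem (.hist y A) = s.mem (.hist y A)

/-- Kripke models: a non-empty set of worlds in which every state arises from the preceding one
by its recorded action, which is closed under the execution of commands, and whose initial states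
have an empty test history (so that all history variables are `0`); and, in every world, an
interpretation of the predicate symbols that are not built in, unaffected by the execution of
commands. -/
structure Model (J : Interp S) where
  worlds : Set (World S)
  nonempty : worlds.Nonempty
  initial : ∀ s : State S, ⟨s, []⟩ ∈ worlds →
    s.act = none ∧ (∀ d, s.hist d = 0) ∧ ∀ y A, s.mem (.hist y A) = some (.int 0)
  backward : ∀ (w : World S) (s : State S), w.push s ∈ worlds →
    w ∈ worlds ∧ ∃ a, s.act = some a ∧ Trans J a w.cur s
  forward : ∀ (w : World S) (c : Cmd S) (s : State S), w ∈ worlds → CmdStep J c w.cur s →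
    w.push s ∈ worlds
  val : World S → (R : S.Rel) → Set (Fin (S.relArity R) → Data S.Other)
  val_cmd : ∀ (w : World S) (c : Cmd S) (s : State S), w.push s ∈ worlds →
    s.act = some (.cmd c) → val (w.push s) = val w

/-! ## Semantics of the assertion language -/

/-- The value of an assertion term under an assignment and an interpretation of the integer
variables by finite tuples of integers. -/
def evalA (J : Interp S) (m : Mem S) (ι : IntVar → List ℤ) (u : ATerm S) : Val S :=
  u.eval J (Sum.elim m (fun i => some (ofTuple (ι i))))

/-- The sampling `d ∼ D ^ n` has been performed in the world. -/
def World.HasSampling (w : World S) (d : Dataset S) (D : Pop S) (n : ℕ) : Prop :=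
  ∃ s ∈ w.states, s.act = some (.smpl d D n)

/-- Satisfaction of quantifier-free formulas. -/
def Model.satBase {J : Interp S} (M : Model J) (ι : IntVar → List ℤ) :
    World S → BaseFml S → Prop
  | w, .eq u v => ∃ o : Data S.Other, evalA J w.cur.mem ι u = some o ∧
      evalA J w.cur.mem ι v = some o
  | w, .sampledN d D n => ∃ (δ : Dataset S) (μ : Pop S) (k : ℕ),
      evalA J w.cur.mem ι d = some (ofDataset δ) ∧
      evalA J w.cur.mem ι D = some (.dist S.dim μ) ∧
      evalA J w.cur.mem ι n = some (.int k) ∧ w.HasSampling δ μ k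
  | w, .sampled d D => ∃ (δ : Dataset S) (μ : Pop S) (k : ℕ),
      evalA J w.cur.mem ι d = some (ofDataset δ) ∧
      evalA J w.cur.mem ι D = some (.dist S.dim μ) ∧ w.HasSampling δ μ k
  | w, .tau r y A ε => ∃ (δ : Dataset S) (x : ℝ),
      w.cur.mem y = some (ofDataset δ) ∧ evalA J w.cur.mem ι ε = some (.real x) ∧
      0 ≤ x ∧ x ≤ 1 ∧ r.holds ((J.test A).pValue δ) x
  | w, .rel R args => ∃ o ∈ M.val w R, ∀ j, evalA J w.cur.mem ι (args j) = some (o j)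
  | w, .neg φ => ¬ M.satBase ι w φ
  | w, .and φ ψ => M.satBase ι w φ ∧ M.satBase ι w ψ
  | w, .know φ => ∀ w' ∈ M.worlds, w.observe = w'.observe → M.satBase ι w' φ

/-- Satisfaction of formulas. -/
def Model.sat {J : Interp S} (M : Model J) : (IntVar → List ℤ) → World S → Fml S → Prop
  | ι, w, .base φ => M.satBase ι w φ
  | ι, w, .neg φ => ¬ M.sat ι w φ
  | ι, w, .and φ ψ => M.sat ι w φ ∧ M.sat ι w ψ
  | ι, w, .all i φ => ∀ t : List ℤ, M.sat (Function.update ι i t) w φ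

/-- The extension of a formula. -/
def Model.ext {J : Interp S} (M : Model J) (ι : IntVar → List ℤ) (φ : Fml S) :
    Set (World S) :=
  {w | w ∈ M.worlds ∧ M.sat ι w φ}

/-- The weakest precondition of a formula with respect to a program. -/
def Model.wp {J : Interp S} (M : Model J) (ι : IntVar → List ℤ) (C : Prog S) (φ : Fml S) :
    Set (World S) :=
  {w | w ∈ M.worlds ∧ ∀ w' ∈ C.sem J w, M.sat ι w' φ}

/-! ## Encoding of data by integer tuples -/

/-- The values generated by the function symbols in `T` from the values of the variables. -/
inductive Gen (J : Interp S) (T : Set (Sym S)) (x : S.Obs → Val S) : Val S → Prop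
  | var (y : S.Obs) : Gen J T x (x y)
  | app (f : Sym S) (hf : f ∈ T) (a : Fin f.arity → Val S) (ha : ∀ j, Gen J T x (a j)) :
      Gen J T x (J.sym f a)

/-- The data of the program are encodable: there is a term `δ`, with the observable variables and
one additional variable, such that every value generated by the function symbols of the program
from values `x` of the observable variables is `δ(t, x)` for some finite tuple `t` of integers. -/
def Prog.Encodable (J : Interp S) (C : Prog S) : Prop :=
  ∃ δ : Term S (Option S.Obs), ∀ (x : S.Obs → Val S) (o : Val S), Gen J C.syms x o →
    ∃ t : List ℤ, δ.eval J (fun z => z.elim (some (ofTuple t)) x) = o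

end BHL

end

noncomputable section

namespace BHL

variable {S : Vocab}

-- An execution is a sequence of labels: commands, and guards with their truth value. A label acts
-- on the observable variables by a substitution of program terms, adds a fixed number to each
-- history variable, and leaves the other invisible variables, the recorded samplings and the
-- valuation of predicates alone. Its executability and its effect on the observation depend only on
-- the observation. So a fixed sequence of labels leading from `w` to `w'` matches the worlds
-- indistinguishable from `w` with those indistinguishable from `w'`: forward because the same
-- labels can be executed there, backward because actions are observable and a Kripke model contains
-- the predecessors of its worlds. Hence a substitution that describes the execution in all worlds
-- indistinguishable from `w` passes through the knowledge modality (`BaseFml.exists_subst`,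
-- `Fml.exists_subst`).
--
-- For one label this gives the weakest precondition "if executable, then the substituted formula"
-- (`Fml.exists_wp_lbl`). A loop-free program has finitely many first steps, each leaving a smaller
-- residual program, so finite conjunctions and recursion on the size suffice.
--
-- With loops, a final value of an observable variable has the form `δ(t, x)`, where `x` are the
-- initial observable values. The formula says: for every family `b` of tuples, if `b` codes a
-- reachable final configuration, then `φ` holds after each observable variable is replaced by `δ`
-- at its component of `b` and each history variable is increased by the length of its component.
-- The quantifier over `b` stands outside the modality. This is harmless, because a code is read
-- relative to observable values only and so means the same in all indistinguishable worlds.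
--
-- Reachability is definable (`Dfn.reachCode`): there are only finitely many residual programs, so a
-- configuration is a finite family of tuples and one step is a Boolean combination of term
-- equations. Closure under reflexive transitive closure (`Dfn.reflTransGen`) holds since a finite
-- sequence of tuples is coded by two tuples, one of offsets and one of concatenated entries, and is
-- decoded with `len`, `nth` and addition alone.

attribute [instance] Vocab.finObs Vocab.finTest

/-! ## Terms -/

/-- Simultaneous substitution. -/
def Term.bind {V W : Type} (σ : V → Term S W) : Term S V → Term S W
  | .var v => σ v
  | .app f args => .app f fun j => (args j).bind σ

theorem Term.eval_bind (J : Interp S) {V W : Type} (σ : V → Term S W) (ρ : W → Val S)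
    (u : Term S V) : (u.bind σ).eval J ρ = u.eval J (fun v => (σ v).eval J ρ) := by
  induction u with
  | var v => rfl
  | app f args ih => simp only [Term.bind, Term.eval, ih]

namespace Term

variable {V : Type}

def tBool (b : Bool) : Term S V := .app (.boolLit b) Fin.elim0
def tInt (z : ℤ) : Term S V := .app (.intLit z) Fin.elim0
def tReal (q : ℚ) : Term S V := .app (.realLit q) Fin.elim0
def tAdd (u v : Term S V) : Term S V := .app .add (![u, v] : Fin 2 → Term S V)
def tLe (u v : Term S V) : Term S V := .app .le (![u, v] : Fin 2 → Term S V)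
def tNth (u v : Term S V) : Term S V := .app .nth (![u, v] : Fin 2 → Term S V)
def tLen (u : Term S V) : Term S V := .app .len (fun _ => u)
def tTest (A : S.Test) (u : Term S V) : Term S V := .app (.test A) (fun _ => u)

variable (J : Interp S) (ρ : V → Val S)

@[simp] theorem eval_var (v : V) : (Term.var v : Term S V).eval J ρ = ρ v := rfl
@[simp] theorem eval_tBool (b : Bool) :
    (tBool b : Term S V).eval J ρ = some (.bool b) := rfl
@[simp] theorem eval_tInt (z : ℤ) : (tInt z : Term S V).eval J ρ = some (.int z) := rfl
@[simp] theorem eval_tReal (q : ℚ) : (tReal q : Term S V).eval J ρ = some (.real q) := rfl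
@[simp] theorem eval_tAdd (u v : Term S V) :
    (tAdd u v).eval J ρ = addVal (u.eval J ρ) (v.eval J ρ) := rfl
@[simp] theorem eval_tLe (u v : Term S V) :
    (tLe u v).eval J ρ = leVal (u.eval J ρ) (v.eval J ρ) := rfl
@[simp] theorem eval_tNth (u v : Term S V) :
    (tNth u v).eval J ρ = nthVal (u.eval J ρ) (v.eval J ρ) := rfl
@[simp] theorem eval_tLen (u : Term S V) :
    (tLen u).eval J ρ = lenVal (u.eval J ρ) := rfl
@[simp] theorem eval_tTest (A : S.Test) (u : Term S V) :
    (tTest A u).eval J ρ = J.testVal A (u.eval J ρ) := rfl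

end Term

@[simp] theorem addVal_int (a b : ℤ) :
    addVal (some (.int a) : Val S) (some (.int b)) = some (.int (a + b)) := rfl

theorem ofDataset_injective : Function.Injective (ofDataset (S := S)) := by
  intro d d' h
  unfold ofDataset at h
  injection h with h
  refine List.map_injective_iff.2 ?_ h
  intro v v' h
  injection h with h
  have := List.ofFn_injective h
  funext j
  have := congrFun this j
  injection this

theorem Interp.testVal_ofDataset (J : Interp S) (A : S.Test) (d : Dataset S) :
    J.testVal A (some (ofDataset d)) = some (.real ((J.test A).pValue d)) := by
  have h : ∃ d' : Dataset S, (some (ofDataset d) : Val S) = some (ofDataset d') := ⟨d, rfl⟩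
  have e : h.choose = d := (ofDataset_injective (Option.some.inj h.choose_spec)).symm
  unfold Interp.testVal
  rw [dif_pos h, e]

theorem Interp.testVal_eq_some {J : Interp S} {A : S.Test} {o : Val S} {p : Data S.Other}
    (h : J.testVal A o = some p) :
    ∃ d : Dataset S, o = some (ofDataset d) ∧ p = .real ((J.test A).pValue d) := by
  by_cases hd : ∃ d : Dataset S, o = some (ofDataset d)
  · obtain ⟨d, rfl⟩ := hd
    rw [testVal_ofDataset] at h
    exact ⟨d, rfl, (Option.some.inj h).symm⟩
  · unfold Interp.testVal at h
    rw [dif_neg hd] at h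
    cases h

theorem testTerm_injective {A A' : S.Test} {y y' : S.Obs} (h : testTerm A y = testTerm A' y') :
    A = A' ∧ y = y' := by
  unfold testTerm at h
  injection h with h₁ h₂
  injection h₁ with h₁
  subst h₁
  have := congrFun h₂ (0 : Fin 1)
  injection this with this
  exact ⟨rfl, this⟩

/-! ## Labelled transitions of programs -/

variable (S) in
/-- Labels of program steps: commands, and guards with their value. -/
inductive Lbl : Type
  | cmd (c : Cmd S)
  | guard (e : PTerm S) (b : Bool)

/-- The values of the observable variables. -/
def World.obs (w : World S) : S.Obs → Val S := fun x => w.cur.mem (.obs x)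

/-- The effect of a label on worlds. -/
def Lbl.Step (J : Interp S) : Lbl S → World S → World S → Prop
  | .cmd c, w, w' => ∃ s, CmdStep J c w.cur s ∧ w' = w.push s
  | .guard e b, w, w' => evalP J w.cur.mem e = some (.bool b) ∧ w' = w

/-- The possible first steps of a program, with the residual program (`none` if finished). -/
def Prog.next : Prog S → List (Lbl S × Option (Prog S))
  | .cmd c => [(.cmd c, none)]
  | .seq C₁ C₂ => C₁.next.map fun p => (p.1, some (p.2.elim C₂ fun C => .seq C C₂))
  | .par C₁ C₂ => (C₁.next.map fun p => (p.1, some (p.2.elim C₂ fun C => .par C C₂))) ++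
      (C₂.next.map fun p => (p.1, some (p.2.elim C₁ fun C => .par C₁ C)))
  | .cond e C₁ C₂ => [(.guard e true, some C₁), (.guard e false, some C₂)]
  | .loop e C => [(.guard e true, some (.seq C (.loop e C))), (.guard e false, none)]

/-- The configuration of an optional residual program. -/
def Conf.mk (r : Option (Prog S)) (w : World S) : Conf S := r.elim (.done w) fun C => .run C w

theorem Step.exists_next {J : Interp S} {c c' : Conf S} (h : BHL.Step J c c') :
    ∀ C w, c = .run C w →
      ∃ l r w', (l, r) ∈ C.next ∧ l.Step J w w' ∧ c' = Conf.mk r w' := by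
  induction h with
  | @cmd c w s hs =>
    rintro C w' ⟨⟩
    exact ⟨.cmd c, none, _, by simp [Prog.next], ⟨s, hs, rfl⟩, rfl⟩
  | @seqDone C₁ C₂ w w' h ih =>
    rintro C w ⟨⟩
    obtain ⟨l, r, w'', hm, hs, he⟩ := ih _ _ rfl
    cases r with
    | some r => cases he
    | none =>
      cases he
      exact ⟨l, some C₂, _, List.mem_map.2 ⟨_, hm, rfl⟩, hs, rfl⟩
  | @seqRun C₁ C₂ C₁' w w' h ih =>
    rintro C w ⟨⟩
    obtain ⟨l, r, w'', hm, hs, he⟩ := ih _ _ rfl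
    cases r with
    | none => cases he
    | some r =>
      cases he
      exact ⟨l, some (.seq C₁' C₂), _, List.mem_map.2 ⟨_, hm, rfl⟩, hs, rfl⟩
  | @condTrue e C₁ C₂ w h =>
    rintro C w ⟨⟩
    exact ⟨.guard e true, some C₁, _, by simp [Prog.next], ⟨h, rfl⟩, rfl⟩
  | @condFalse e C₁ C₂ w h =>
    rintro C w ⟨⟩
    exact ⟨.guard e false, some C₂, _, by simp [Prog.next], ⟨h, rfl⟩, rfl⟩
  | @loopTrue e C w h =>
    rintro C w ⟨⟩
    exact ⟨.guard e true, some _, _, by simp [Prog.next], ⟨h, rfl⟩, rfl⟩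
  | @loopFalse e C w h =>
    rintro C w ⟨⟩
    exact ⟨.guard e false, none, _, by simp [Prog.next], ⟨h, rfl⟩, rfl⟩
  | @parLeftRun C₁ C₂ C₁' w w' h ih =>
    rintro C w ⟨⟩
    obtain ⟨l, r, w'', hm, hs, he⟩ := ih _ _ rfl
    cases r with
    | none => cases he
    | some r =>
      cases he
      exact ⟨l, some (.par C₁' C₂), _,
        List.mem_append_left _ (List.mem_map.2 ⟨_, hm, rfl⟩), hs, rfl⟩
  | @parLeftDone C₁ C₂ w w' h ih =>
    rintro C w ⟨⟩
    obtain ⟨l, r, w'', hm, hs, he⟩ := ih _ _ rfl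
    cases r with
    | some r => cases he
    | none =>
      cases he
      exact ⟨l, some C₂, _, List.mem_append_left _ (List.mem_map.2 ⟨_, hm, rfl⟩), hs, rfl⟩
  | @parRightRun C₁ C₂ C₂' w w' h ih =>
    rintro C w ⟨⟩
    obtain ⟨l, r, w'', hm, hs, he⟩ := ih _ _ rfl
    cases r with
    | none => cases he
    | some r =>
      cases he
      exact ⟨l, some (.par C₁ C₂'), _,
        List.mem_append_right _ (List.mem_map.2 ⟨_, hm, rfl⟩), hs, rfl⟩
  | @parRightDone C₁ C₂ w w' h ih =>
    rintro C w ⟨⟩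
    obtain ⟨l, r, w'', hm, hs, he⟩ := ih _ _ rfl
    cases r with
    | some r => cases he
    | none =>
      cases he
      exact ⟨l, some C₁, _, List.mem_append_right _ (List.mem_map.2 ⟨_, hm, rfl⟩), hs, rfl⟩

theorem Step.of_next {J : Interp S} (C : Prog S) : ∀ {l : Lbl S} {r : Option (Prog S)}
    {w w' : World S}, (l, r) ∈ C.next → l.Step J w w' →
      BHL.Step J (.run C w) (Conf.mk r w') := by
  induction C with
  | cmd c =>
    intro l r w w' hm hs
    simp only [Prog.next, List.mem_singleton, Prod.mk.injEq] at hm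
    obtain ⟨rfl, rfl⟩ := hm
    obtain ⟨s, hs, rfl⟩ := hs
    exact .cmd hs
  | seq C₁ C₂ ih₁ ih₂ =>
    intro l r w w' hm hs
    obtain ⟨⟨l, r⟩, hm', he⟩ := List.mem_map.1 hm
    cases he
    have := ih₁ hm' hs
    cases r with
    | none => exact .seqDone this
    | some C => exact .seqRun this
  | par C₁ C₂ ih₁ ih₂ =>
    intro l r w w' hm hs
    rcases List.mem_append.1 hm with hm | hm
    · obtain ⟨⟨l, r⟩, hm', he⟩ := List.mem_map.1 hm
      cases he
      have := ih₁ hm' hs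
      cases r with
      | none => exact .parLeftDone this
      | some C => exact .parLeftRun this
    · obtain ⟨⟨l, r⟩, hm', he⟩ := List.mem_map.1 hm
      cases he
      have := ih₂ hm' hs
      cases r with
      | none => exact .parRightDone this
      | some C => exact .parRightRun this
  | cond e C₁ C₂ ih₁ ih₂ =>
    intro l r w w' hm hs
    simp only [Prog.next, List.mem_cons, Prod.mk.injEq, List.not_mem_nil, or_false] at hm
    rcases hm with ⟨rfl, rfl⟩ | ⟨rfl, rfl⟩
    · obtain ⟨hs, rfl⟩ := hs
      exact .condTrue hs
    · obtain ⟨hs, rfl⟩ := hs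
      exact .condFalse hs
  | loop e C ih =>
    intro l r w w' hm hs
    simp only [Prog.next, List.mem_cons, Prod.mk.injEq, List.not_mem_nil, or_false] at hm
    rcases hm with ⟨rfl, rfl⟩ | ⟨rfl, rfl⟩
    · obtain ⟨hs, rfl⟩ := hs
      exact .loopTrue hs
    · obtain ⟨hs, rfl⟩ := hs
      exact .loopFalse hs

theorem Step.run_iff {J : Interp S} {C : Prog S} {w : World S} {c : Conf S} :
    BHL.Step J (.run C w) c ↔
      ∃ l r w', (l, r) ∈ C.next ∧ l.Step J w w' ∧ c = Conf.mk r w' :=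
  ⟨fun h => h.exists_next _ _ rfl, by rintro ⟨l, r, w', hm, hs, rfl⟩; exact of_next C hm hs⟩

theorem Step.not_done {J : Interp S} {w : World S} {c : Conf S} :
    ¬ BHL.Step J (.done w) c := by
  rintro ⟨⟩

/-- A final world of `C` is reached by one step, followed by an execution of the residual
program. -/
theorem Prog.mem_sem_iff {J : Interp S} {C : Prog S} {w w' : World S} :
    w' ∈ C.sem J w ↔ ∃ l r w₁, (l, r) ∈ C.next ∧ l.Step J w w₁ ∧
      r.elim (w' = w₁) fun C' => w' ∈ C'.sem J w₁ := by
  constructor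
  · intro h
    obtain ⟨c, h₁, h₂⟩ := Relation.TransGen.head'_iff.1 h
    obtain ⟨l, r, w₁, hm, hs, rfl⟩ := Step.run_iff.1 h₁
    refine ⟨l, r, w₁, hm, hs, ?_⟩
    cases r with
    | none =>
      rcases h₂.cases_head with h | ⟨c, h, -⟩
      · injection h with h
        exact h.symm
      · exact (Step.not_done h).elim
    | some C' =>
      rcases Relation.reflTransGen_iff_eq_or_transGen.1 h₂ with h | h
      · cases h
      · exact h
  · rintro ⟨l, r, w₁, hm, hs, h⟩
    have h₁ := Step.of_next C hm hs
    cases r with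
    | none =>
      cases h
      exact .single h₁
    | some C' => exact .head h₁ h

/-! ## Syntactic invariants of residual programs -/

/-- Unfolding a loop only produces a residual of the body followed by the same loop, and finishing
the body returns to the loop itself; residuals of a parallel composition are pairs of residuals, or
residuals of one side. Thus the control state has finitely many values even when executions are
unbounded. -/
theorem Prog.exists_residuals (C : Prog S) : ∃ L : Set (Prog S), L.Finite ∧ C ∈ L ∧
    ∀ C' ∈ L, ∀ l C'', (l, some C'') ∈ C'.next → C'' ∈ L := by
  induction C with
  | cmd c =>
    refine ⟨{.cmd c}, Set.finite_singleton _, rfl, ?_⟩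
    rintro C' rfl l C'' h
    simp [next] at h
  | seq C₁ C₂ ih₁ ih₂ =>
    obtain ⟨L₁, f₁, m₁, c₁⟩ := ih₁
    obtain ⟨L₂, f₂, m₂, c₂⟩ := ih₂
    refine ⟨(fun C => .seq C C₂) '' L₁ ∪ L₂, (f₁.image _).union f₂, .inl ⟨_, m₁, rfl⟩, ?_⟩
    rintro C' (⟨C, hC, rfl⟩ | hC) l C'' h
    · obtain ⟨⟨l, r⟩, hm, he⟩ := List.mem_map.1 h
      cases he
      cases r with
      | none => exact .inr m₂
      | some D => exact .inl ⟨D, c₁ _ hC _ _ hm, rfl⟩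
    · exact .inr (c₂ _ hC _ _ h)
  | par C₁ C₂ ih₁ ih₂ =>
    obtain ⟨L₁, f₁, m₁, c₁⟩ := ih₁
    obtain ⟨L₂, f₂, m₂, c₂⟩ := ih₂
    refine ⟨Set.image2 .par L₁ L₂ ∪ (L₁ ∪ L₂), (f₁.image2 _ f₂).union (f₁.union f₂),
      .inl ⟨_, m₁, _, m₂, rfl⟩, ?_⟩
    rintro C' (⟨C, hC, D, hD, rfl⟩ | hC | hC) l C'' h
    · rcases List.mem_append.1 h with h | h
      · obtain ⟨⟨l, r⟩, hm, he⟩ := List.mem_map.1 h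
        cases he
        cases r with
        | none => exact .inr (.inr hD)
        | some E => exact .inl ⟨E, c₁ _ hC _ _ hm, D, hD, rfl⟩
      · obtain ⟨⟨l, r⟩, hm, he⟩ := List.mem_map.1 h
        cases he
        cases r with
        | none => exact .inr (.inl hC)
        | some E => exact .inl ⟨C, hC, E, c₂ _ hD _ _ hm, rfl⟩
    · exact .inr (.inl (c₁ _ hC _ _ h))
    · exact .inr (.inr (c₂ _ hC _ _ h))
  | cond e C₁ C₂ ih₁ ih₂ =>
    obtain ⟨L₁, f₁, m₁, c₁⟩ := ih₁
    obtain ⟨L₂, f₂, m₂, c₂⟩ := ih₂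
    refine ⟨insert (.cond e C₁ C₂) (L₁ ∪ L₂), (f₁.union f₂).insert _, .inl rfl, ?_⟩
    rintro C' (rfl | hC | hC) l C'' h
    · simp only [next, List.mem_cons, Prod.mk.injEq, Option.some.injEq, List.not_mem_nil,
        or_false] at h
      rcases h with ⟨-, rfl⟩ | ⟨-, rfl⟩
      · exact .inr (.inl m₁)
      · exact .inr (.inr m₂)
    · exact .inr (.inl (c₁ _ hC _ _ h))
    · exact .inr (.inr (c₂ _ hC _ _ h))
  | loop e C ih =>
    obtain ⟨L, f, m, c⟩ := ih
    refine ⟨insert (.loop e C) ((fun D => .seq D (.loop e C)) '' L), (f.image _).insert _,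
      .inl rfl, ?_⟩
    rintro C' (rfl | ⟨D, hD, rfl⟩) l C'' h
    · simp only [next, List.mem_cons, Prod.mk.injEq, Option.some.injEq, List.not_mem_nil,
        or_false, reduceCtorEq, and_false] at h
      obtain ⟨-, rfl⟩ := h
      exact .inr ⟨C, m, rfl⟩
    · obtain ⟨⟨l, r⟩, hm, he⟩ := List.mem_map.1 h
      cases he
      cases r with
      | none => exact .inl rfl
      | some E => exact .inr ⟨E, c _ hD _ _ hm, rfl⟩

/-- The function symbols of a label. -/
def Lbl.syms : Lbl S → Set (Sym S)
  | .cmd c => c.syms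
  | .guard e _ => e.syms

/-- Keeps all values computed along an execution within those generated by the symbols of the
initial program, to which encodability applies. -/
theorem Prog.syms_of_mem_next (C : Prog S) : ∀ {l : Lbl S} {r : Option (Prog S)},
    (l, r) ∈ C.next → l.syms ⊆ C.syms ∧ ∀ C' ∈ r, C'.syms ⊆ C.syms := by
  induction C with
  | cmd c =>
    intro l r h
    simp only [next, List.mem_singleton, Prod.mk.injEq] at h
    obtain ⟨rfl, rfl⟩ := h
    exact ⟨subset_rfl, by simp⟩
  | seq C₁ C₂ ih₁ ih₂ =>
    intro l r h
    obtain ⟨⟨l, r⟩, hm, he⟩ := List.mem_map.1 h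
    cases he
    obtain ⟨h₁, h₂⟩ := ih₁ hm
    refine ⟨h₁.trans Set.subset_union_left, ?_⟩
    rintro C' ⟨⟩
    cases r with
    | none => exact Set.subset_union_right
    | some D => exact Set.union_subset_union_left _ (h₂ D rfl)
  | par C₁ C₂ ih₁ ih₂ =>
    intro l r h
    rcases List.mem_append.1 h with h | h
    · obtain ⟨⟨l, r⟩, hm, he⟩ := List.mem_map.1 h
      cases he
      obtain ⟨h₁, h₂⟩ := ih₁ hm
      refine ⟨h₁.trans Set.subset_union_left, ?_⟩
      rintro C' ⟨⟩
      cases r with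
      | none => exact Set.subset_union_right
      | some D => exact Set.union_subset_union_left _ (h₂ D rfl)
    · obtain ⟨⟨l, r⟩, hm, he⟩ := List.mem_map.1 h
      cases he
      obtain ⟨h₁, h₂⟩ := ih₂ hm
      refine ⟨h₁.trans Set.subset_union_right, ?_⟩
      rintro C' ⟨⟩
      cases r with
      | none => exact Set.subset_union_left
      | some D => exact Set.union_subset_union_right _ (h₂ D rfl)
  | cond e C₁ C₂ ih₁ ih₂ =>
    intro l r h
    simp only [next, List.mem_cons, Prod.mk.injEq, List.not_mem_nil, or_false] at h
    have he : e.syms ⊆ (cond e C₁ C₂).syms :=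
      Set.subset_union_left.trans Set.subset_union_left
    rcases h with ⟨rfl, rfl⟩ | ⟨rfl, rfl⟩
    · refine ⟨he, ?_⟩
      rintro C' ⟨⟩
      exact Set.subset_union_right.trans Set.subset_union_left
    · refine ⟨he, ?_⟩
      rintro C' ⟨⟩
      exact Set.subset_union_right
  | loop e C ih =>
    intro l r h
    simp only [next, List.mem_cons, Prod.mk.injEq, List.not_mem_nil, or_false] at h
    rcases h with ⟨rfl, rfl⟩ | ⟨rfl, rfl⟩
    · refine ⟨Set.subset_union_left, ?_⟩
      rintro C' ⟨⟩
      exact Set.union_subset Set.subset_union_right subset_rfl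
    · exact ⟨Set.subset_union_left, by simp⟩

/-- The size of a program, which decreases along the steps of a loop-free program. -/
def Prog.size : Prog S → ℕ
  | .cmd _ => 1
  | .seq C₁ C₂ => C₁.size + C₂.size + 1
  | .par C₁ C₂ => C₁.size + C₂.size + 1
  | .cond _ C₁ C₂ => C₁.size + C₂.size + 1
  | .loop _ C => C.size + 1

theorem Prog.size_of_mem_next (C : Prog S) : ∀ {l : Lbl S} {C' : Prog S}, ¬ C.HasLoop →
    (l, some C') ∈ C.next → ¬ C'.HasLoop ∧ C'.size < C.size := by
  induction C with
  | cmd c =>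
    intro l C' _ h
    simp [next] at h
  | seq C₁ C₂ ih₁ ih₂ =>
    intro l C' hl h
    obtain ⟨⟨l, r⟩, hm, he⟩ := List.mem_map.1 h
    cases he
    simp only [HasLoop, not_or] at hl
    cases r with
    | none => exact ⟨hl.2, by simp only [size, Option.elim]; omega⟩
    | some D =>
      obtain ⟨h₁, h₂⟩ := ih₁ hl.1 hm
      exact ⟨by simp [HasLoop, h₁, hl.2], by simp only [size, Option.elim]; omega⟩
  | par C₁ C₂ ih₁ ih₂ =>
    intro l C' hl h
    simp only [HasLoop, not_or] at hl
    rcases List.mem_append.1 h with h | h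
    · obtain ⟨⟨l, r⟩, hm, he⟩ := List.mem_map.1 h
      cases he
      cases r with
      | none => exact ⟨hl.2, by simp only [size, Option.elim]; omega⟩
      | some D =>
        obtain ⟨h₁, h₂⟩ := ih₁ hl.1 hm
        exact ⟨by simp [HasLoop, h₁, hl.2], by simp only [size, Option.elim]; omega⟩
    · obtain ⟨⟨l, r⟩, hm, he⟩ := List.mem_map.1 h
      cases he
      cases r with
      | none => exact ⟨hl.1, by simp only [size, Option.elim]; omega⟩
      | some D =>
        obtain ⟨h₁, h₂⟩ := ih₂ hl.2 hm
        exact ⟨by simp [HasLoop, h₁, hl.1], by simp only [size, Option.elim]; omega⟩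
  | cond e C₁ C₂ ih₁ ih₂ =>
    intro l C' hl h
    simp only [HasLoop, not_or] at hl
    simp only [next, List.mem_cons, Prod.mk.injEq, Option.some.injEq, List.not_mem_nil,
      or_false] at h
    rcases h with ⟨rfl, rfl⟩ | ⟨rfl, rfl⟩
    · exact ⟨hl.1, by simp only [size]; omega⟩
    · exact ⟨hl.2, by simp only [size]; omega⟩
  | loop e C ih =>
    intro l C' hl
    exact (hl trivial).elim

open Term

/-! ## The effect of labels on observable variables and history variables -/

open Classical in
/-- The label can be executed if `lhs` and `rhs` are defined and have the same value. -/
def Lbl.lhs : Lbl S → PTerm S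
  | .cmd .skip => tBool true
  | .cmd (.assign _ e) => if ∃ A y, e = testTerm A y then e else tBool true
  | .guard e _ => e

/-- The atom `eq` demands that both sides be defined, so repeating the left side expresses mere
definedness. For a test this is exactly that the tested variable holds a dataset; for other commands
the equation is trivially true. -/
def Lbl.rhs : Lbl S → PTerm S
  | .guard _ b => tBool b
  | .cmd c => lhs (.cmd c)

/-- Executability of a label. -/
def Lbl.Ok (J : Interp S) (l : Lbl S) (X : S.Obs → Val S) : Prop :=
  ∃ o, l.lhs.eval J X = some o ∧ l.rhs.eval J X = some o

open Classical in
/-- The term denoting the new value of a variable. -/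
def Lbl.tm : Lbl S → S.Obs → PTerm S
  | .cmd (.assign v e) => Function.update .var v e
  | _ => .var

open Classical in
/-- The increment of a history variable. -/
def Lbl.cnt : Lbl S → S.Obs → S.Test → ℕ
  | .cmd (.assign _ e), y, A => if e = testTerm A y then 1 else 0
  | _, _, _ => 0

theorem Lbl.ok_of_not_test (J : Interp S) {v : S.Obs} {e : PTerm S}
    (he : ∀ A y, e ≠ testTerm A y) (X : S.Obs → Val S) : (cmd (.assign v e)).Ok J X := by
  have h : ¬ ∃ A y, e = testTerm A y := by
    rintro ⟨A, y, h⟩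
    exact he A y h
  refine ⟨.bool true, ?_⟩
  simp only [rhs, lhs, if_neg h]
  exact ⟨rfl, rfl⟩

theorem Lbl.ok_test_iff (J : Interp S) (v : S.Obs) (A : S.Test) (y : S.Obs)
    (X : S.Obs → Val S) : (cmd (.assign v (testTerm A y))).Ok J X ↔
      ∃ d, X y = some (ofDataset d) := by
  have h : ∃ A' y', testTerm A y = testTerm A' y' := ⟨A, y, rfl⟩
  simp only [Ok, rhs, lhs, if_pos h, and_self]
  constructor
  · rintro ⟨o, ho⟩
    obtain ⟨d, hd, -⟩ := Interp.testVal_eq_some ho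
    exact ⟨d, hd⟩
  · rintro ⟨d, hd⟩
    refine ⟨.real ((J.test A).pValue d), ?_⟩
    change J.testVal A (X y) = _
    rw [hd, Interp.testVal_ofDataset]

theorem obs_setMem (m : Mem S) (v : S.Obs) (o : Val S) (x : S.Obs) [Decidable (x = v)] :
    setMem m (.obs v) o (.obs x) = if x = v then o else m (.obs x) := by
  unfold setMem
  split_ifs with h
  · simp [h]
  · simp [h]

/-- Execution of a label changes observable variables according to `tm`, history variables
according to `cnt`, and no other variables. -/
theorem Lbl.Step.spec {J : Interp S} {l : Lbl S} {w w' : World S} (h : l.Step J w w') :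
    l.Ok J w.obs ∧ (∀ x, w'.obs x = (l.tm x).eval J w.obs) ∧
      (∀ z, w'.cur.mem (.inv z) = w.cur.mem (.inv z)) ∧
      ∀ y A k, w.cur.mem (.hist y A) = some (.int k) →
        w'.cur.mem (.hist y A) = some (.int (k + l.cnt y A)) := by
  classical
  cases l with
  | guard e b =>
    obtain ⟨h, rfl⟩ := h
    exact ⟨⟨_, h, rfl⟩, fun x => rfl, fun z => rfl, fun y A k hk => by simpa [cnt] using hk⟩
  | cmd c =>
    obtain ⟨s, hs, rfl⟩ := h
    cases hs with
    | skip =>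
      exact ⟨⟨_, rfl, rfl⟩, fun x => rfl, fun z => rfl,
        fun y A k hk => by simpa [cnt, World.push] using hk⟩
    | assign _ v e he =>
      refine ⟨ok_of_not_test J he _, fun x => ?_, fun z => ?_, fun y A k hk => ?_⟩
      · change setMem _ _ _ _ = _
        rw [obs_setMem, tm, Function.update_apply]
        split_ifs <;> rfl
      · change setMem _ _ _ _ = _
        simp [setMem]
      · change setMem _ _ _ _ = _
        simpa [setMem, cnt, he] using hk
    | test _ v A y d hd =>
      refine ⟨(ok_test_iff J v A y _).2 ⟨d, hd⟩, fun x => ?_, fun z => ?_,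
        fun y' A' k hk => ?_⟩
      · change setMem (setMem _ _ _) _ _ _ = _
        rw [setMem, Function.update_of_ne (by simp), obs_setMem, tm, Function.update_apply]
        split_ifs <;> rfl
      · change setMem (setMem _ _ _) _ _ _ = _
        simp [setMem]
      · change setMem (setMem _ _ _) _ _ _ = _
        by_cases hy : y' = y ∧ A' = A
        · obtain ⟨rfl, rfl⟩ := hy
          simp [setMem, cnt, hk]
        · have h₁ : testTerm A y ≠ testTerm A' y' := by
            intro h
            obtain ⟨rfl, rfl⟩ := testTerm_injective h
            exact hy ⟨rfl, rfl⟩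
          have h₂ : (Var.hist y' A' : Var S) ≠ .hist y A := by
            intro h
            injection h with h h'
            exact hy ⟨h, h'⟩
          simp [setMem, cnt, h₁, h₂, hk]

/-- Executability is decided by the observable values alone, so it transfers to indistinguishable
worlds and to abstract configurations. -/
theorem Lbl.exists_step {J : Interp S} {l : Lbl S} {w : World S} (h : l.Ok J w.obs) :
    ∃ w', l.Step J w w' := by
  cases l with
  | guard e b =>
    obtain ⟨o, h₁, h₂⟩ := h
    exact ⟨w, h₁.trans h₂.symm, rfl⟩
  | cmd c =>
    cases c with
    | skip => exact ⟨_, _, .skip _, rfl⟩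
    | assign v e =>
      by_cases he : ∃ A y, e = testTerm A y
      · obtain ⟨A, y, rfl⟩ := he
        obtain ⟨d, hd⟩ := (ok_test_iff J v A y _).1 h
        exact ⟨_, _, .test _ _ _ _ d hd, rfl⟩
      · exact ⟨_, _, .assign _ _ _ fun A y h => he ⟨A, y, h⟩, rfl⟩

theorem CmdStep.act_eq {J : Interp S} {c : Cmd S} {s s' : State S} (h : CmdStep J c s s') :
    s'.act = some (.cmd c) := by
  cases h <;> rfl

theorem World.obs_eq {w u : World S} (h : w.observe = u.observe) : w.obs = u.obs :=
  congrArg Prod.fst (List.cons.inj h).1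

theorem World.hist_eq {w u : World S} (h : w.observe = u.observe) : w.cur.hist = u.cur.hist :=
  congrArg (fun p => p.2.2) (List.cons.inj h).1

theorem World.act_eq {w u : World S} (h : w.observe = u.observe) : w.cur.act = u.cur.act :=
  congrArg (fun p => p.2.1) (List.cons.inj h).1

theorem World.observe_push (w : World S) (s : State S) :
    (w.push s).observe = s.observe :: w.observe := rfl

/-- The observation of the result of a command is determined by the observation before it. -/
theorem Lbl.Step.observe_eq {J : Interp S} {l : Lbl S} {w w' u u' : World S}
    (h : l.Step J w w') (h' : l.Step J u u') (hw : w.observe = u.observe) :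
    w'.observe = u'.observe := by
  have ho : w'.obs = u'.obs := by
    funext x
    rw [h.spec.2.1, h'.spec.2.1, World.obs_eq hw]
  cases l with
  | guard e b =>
    obtain ⟨-, rfl⟩ := h
    obtain ⟨-, rfl⟩ := h'
    exact hw
  | cmd c =>
    obtain ⟨s, hs, rfl⟩ := h
    obtain ⟨t, ht, rfl⟩ := h'
    rw [World.observe_push, World.observe_push, hw]
    congr 1
    refine Prod.ext ho (Prod.ext (hs.act_eq.trans ht.act_eq.symm) ?_)
    change s.hist = t.hist
    have hH := World.hist_eq hw
    cases hs with
    | skip => cases ht; exact hH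
    | assign _ v e he =>
      cases ht with
      | assign => exact hH
      | test _ v A y d hd => exact (he _ _ rfl).elim
    | test _ v A y d hd =>
      generalize hg : testTerm A y = e at ht
      cases ht with
      | assign _ _ _ he => exact (he _ _ hg.symm).elim
      | test _ v A' y' d' hd' =>
        obtain ⟨rfl, rfl⟩ := testTerm_injective hg
        -- The tested variable is observable, so both executions record the same dataset in the test
        -- history.
        have : d = d' := ofDataset_injective <| Option.some.inj <| by
          rw [← hd, ← hd']
          exact congrFun (World.obs_eq hw) y
        change Hist.record _ _ _ = Hist.record _ _ _
        rw [this, hH]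

/-! ## Executions of sequences of labels in Kripke models -/

/-- Execution of a sequence of labels. -/
def Exec (J : Interp S) : List (Lbl S) → World S → World S → Prop
  | [], w, w' => w' = w
  | l :: ls, w, w' => ∃ w₁, l.Step J w w₁ ∧ Exec J ls w₁ w'

/-- The total increment of a history variable. -/
def cnts (ls : List (Lbl S)) (y : S.Obs) (A : S.Test) : ℕ := (ls.map fun l => l.cnt y A).sum

namespace Model

variable {J : Interp S} (M : Model J)

/-- Initially the value is `0`, commands add a natural number, samplings change nothing. Without
this, adding an increment by `addVal` could be undefined. -/
theorem exists_hist_eq : ∀ {w : World S}, w ∈ M.worlds → ∀ y A,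
    ∃ k : ℤ, w.cur.mem (.hist y A) = some (.int k) := by
  rintro ⟨s, past⟩ hw y A
  induction past generalizing s with
  | nil => exact ⟨0, (M.initial s hw).2.2 y A⟩
  | cons t past ih =>
    obtain ⟨ht, a, ha, hs⟩ := M.backward ⟨t, past⟩ s hw
    obtain ⟨k, hk⟩ := ih t ht
    cases a with
    | cmd c => exact ⟨_, (Lbl.Step.spec (l := .cmd c) ⟨s, hs, rfl⟩).2.2.2 y A k hk⟩
    | smpl d D n => exact ⟨k, (hs.2.2.2 y A).trans hk⟩

variable {M}

theorem step_mem {l : Lbl S} {w w' : World S} (h : l.Step J w w') (hw : w ∈ M.worlds) :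
    w' ∈ M.worlds := by
  cases l with
  | guard e b => exact h.2 ▸ hw
  | cmd c =>
    obtain ⟨s, hs, rfl⟩ := h
    exact M.forward w c s hw hs

theorem step_val_eq {l : Lbl S} {w w' : World S} (h : l.Step J w w') (hw : w ∈ M.worlds) :
    M.val w' = M.val w := by
  cases l with
  | guard e b => rw [h.2]
  | cmd c =>
    obtain ⟨s, hs, rfl⟩ := h
    exact M.val_cmd w c s (M.forward w c s hw hs) hs.act_eq

/-- Backward half of the matching. The last action is part of the observation, so `u'` also ends
with this command, and the model contains the world before it. For a guard, `u'` itself serves,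
since the guard only reads observable variables. -/
theorem exists_step_of_observe_eq {l : Lbl S} {w w' u' : World S} (h : l.Step J w w')
    (hu : u' ∈ M.worlds) (hw : w'.observe = u'.observe) :
    ∃ u ∈ M.worlds, w.observe = u.observe ∧ l.Step J u u' := by
  cases l with
  | guard e b =>
    obtain ⟨h, rfl⟩ := h
    refine ⟨u', hu, hw, ?_, rfl⟩
    rw [← h]
    exact congrArg (fun X => e.eval J X) (World.obs_eq hw).symm
  | cmd c =>
    obtain ⟨s, hs, rfl⟩ := h
    obtain ⟨t, past⟩ := u'
    cases past with
    | nil =>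
      have := congrArg List.length hw
      simp [World.observe, World.states, World.push] at this
    | cons t' past =>
      obtain ⟨hm, a, ha, ht⟩ := M.backward ⟨t', past⟩ t hu
      refine ⟨⟨t', past⟩, hm, (List.cons.inj hw).2, t, ?_, rfl⟩
      have h₁ : s.act = t.act := World.act_eq hw
      rw [hs.act_eq, ha] at h₁
      cases h₁
      exact ht

theorem exec_mem {ls : List (Lbl S)} : ∀ {w w' : World S}, Exec J ls w w' → w ∈ M.worlds →
    w' ∈ M.worlds := by
  induction ls with
  | nil =>
    rintro w w' rfl hw
    exact hw
  | cons l ls ih =>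
    rintro w w' ⟨w₁, h₁, h⟩ hw
    exact ih h (step_mem h₁ hw)

theorem exec_val_eq {ls : List (Lbl S)} : ∀ {w w' : World S}, Exec J ls w w' → w ∈ M.worlds →
    M.val w' = M.val w := by
  induction ls with
  | nil =>
    rintro w w' rfl hw
    rfl
  | cons l ls ih =>
    rintro w w' ⟨w₁, h₁, h⟩ hw
    rw [ih h (step_mem h₁ hw), step_val_eq h₁ hw]

/-- Forward half of the matching, used with its backward counterpart to move the knowledge modality
across an execution. -/
theorem exists_exec_of_observe_eq {ls : List (Lbl S)} : ∀ {w w' u : World S},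
    Exec J ls w w' → w.observe = u.observe → ∃ u', Exec J ls u u' ∧ w'.observe = u'.observe := by
  induction ls with
  | nil =>
    rintro w w' u rfl h
    exact ⟨u, rfl, h⟩
  | cons l ls ih =>
    rintro w w' u ⟨w₁, h₁, h⟩ hw
    obtain ⟨u₁, hu₁⟩ : ∃ u₁, l.Step J u u₁ :=
      Lbl.exists_step (World.obs_eq hw ▸ h₁.spec.1)
    obtain ⟨u', hu', he⟩ := ih h (h₁.observe_eq hu₁ hw)
    exact ⟨u', ⟨u₁, hu₁, hu'⟩, he⟩

theorem exists_exec_of_observe_eq' {ls : List (Lbl S)} : ∀ {w w' u' : World S},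
    Exec J ls w w' → u' ∈ M.worlds → w'.observe = u'.observe →
    ∃ u ∈ M.worlds, w.observe = u.observe ∧ Exec J ls u u' := by
  induction ls with
  | nil =>
    rintro w w' u rfl hu h
    exact ⟨u, hu, h, rfl⟩
  | cons l ls ih =>
    rintro w w' u' ⟨w₁, h₁, h⟩ hu hw
    obtain ⟨u₁, hm, hu₁, he⟩ := ih h hu hw
    obtain ⟨u, hm, hu, hs⟩ := exists_step_of_observe_eq h₁ hm hu₁
    exact ⟨u, hm, hu, u₁, hs, he⟩

end Model

theorem Exec.observe_eq {J : Interp S} {ls : List (Lbl S)} : ∀ {w w' u u' : World S},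
    Exec J ls w w' → Exec J ls u u' → w.observe = u.observe → w'.observe = u'.observe := by
  induction ls with
  | nil =>
    rintro w w' u u' rfl rfl h
    exact h
  | cons l ls ih =>
    rintro w w' u u' ⟨w₁, h₁, h⟩ ⟨u₁, h₂, h'⟩ hw
    exact ih h h' (h₁.observe_eq h₂ hw)

theorem Lbl.Step.hasSampling_iff {J : Interp S} {l : Lbl S} {w w' : World S}
    (h : l.Step J w w') (d : Dataset S) (D : Pop S) (n : ℕ) :
    w'.HasSampling d D n ↔ w.HasSampling d D n := by
  cases l with
  | guard e b => rw [h.2]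
  | cmd c =>
    obtain ⟨s, hs, rfl⟩ := h
    simp [World.HasSampling, World.states, World.push, hs.act_eq]

theorem Exec.hasSampling_iff {J : Interp S} {ls : List (Lbl S)} : ∀ {w w' : World S},
    Exec J ls w w' → ∀ (d : Dataset S) (D : Pop S) (n : ℕ),
    (w'.HasSampling d D n ↔ w.HasSampling d D n) := by
  induction ls with
  | nil =>
    rintro w w' rfl d D n
    rfl
  | cons l ls ih =>
    rintro w w' ⟨w₁, h₁, h⟩ d D n
    rw [ih h, h₁.hasSampling_iff]

theorem Exec.mem_inv {J : Interp S} {ls : List (Lbl S)} : ∀ {w w' : World S},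
    Exec J ls w w' → ∀ z, w'.cur.mem (.inv z) = w.cur.mem (.inv z) := by
  induction ls with
  | nil =>
    rintro w w' rfl z
    rfl
  | cons l ls ih =>
    rintro w w' ⟨w₁, h₁, h⟩ z
    rw [ih h, h₁.spec.2.2.1]

theorem Exec.mem_hist {J : Interp S} {ls : List (Lbl S)} {y : S.Obs} {A : S.Test} :
    ∀ {w w' : World S} {k : ℤ}, Exec J ls w w' → w.cur.mem (.hist y A) = some (.int k) →
      w'.cur.mem (.hist y A) = some (.int (k + cnts ls y A)) := by
  induction ls with
  | nil =>
    rintro w w' k rfl h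
    simpa [cnts] using h
  | cons l ls ih =>
    rintro w w' k ⟨w₁, h₁, h⟩ hk
    rw [ih h (h₁.spec.2.2.2 _ _ _ hk)]
    simp [cnts, add_assoc]

/-! ## Substitution in formulas -/

/-- The substitution `σ` describes, under the interpretation `ι`, the effect of an execution
from `w` to `w'`, in all worlds that are indistinguishable from `w`. -/
def Model.Simulates {J : Interp S} (M : Model J) (σ : Var S → ATerm S) (ι : IntVar → List ℤ)
    (w w' : World S) : Prop :=
  ∃ ls, Exec J ls w w' ∧ w ∈ M.worlds ∧ ∀ u u', u ∈ M.worlds → w.observe = u.observe →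
    Exec J ls u u' → ∀ z, u'.cur.mem z = evalA J u.cur.mem ι (σ z)

/-- The same labels executed from an indistinguishable world give the same final observation, so for
observable variables it is enough to compare with `w'`. History variables are invisible and may
differ between such worlds, so they are described by their increment. -/
theorem Model.simulates_of_exec {J : Interp S} {M : Model J} {σ : Var S → ATerm S}
    {ι : IntVar → List ℤ} {w w' : World S} {ls : List (Lbl S)} (h : Exec J ls w w')
    (hw : w ∈ M.worlds)
    (hobs : ∀ u : World S, u.obs = w.obs → ∀ x, evalA J u.cur.mem ι (σ (.obs x)) = w'.obs x)
    (hinv : ∀ z, σ (.inv z) = .var (.inl (.inv z)))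
    (hhist : ∀ y A, ∀ m : Mem S, evalA J m ι (σ (.hist y A)) =
      addVal (m (.hist y A)) (some (.int (cnts ls y A)))) :
    M.Simulates σ ι w w' := by
  refine ⟨ls, h, hw, fun u u' hu hwu he z => ?_⟩
  cases z with
  | obs x =>
    rw [hobs u (World.obs_eq hwu).symm]
    exact (congrFun (World.obs_eq (h.observe_eq he hwu)) x).symm
  | inv z =>
    rw [hinv, he.mem_inv]
    rfl
  | hist y A =>
    obtain ⟨k, hk⟩ := M.exists_hist_eq hu y A
    rw [hhist, he.mem_hist hk, hk, addVal_int]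

/-- The extension of a substitution of variables to integer variables. -/
def substA (σ : Var S → ATerm S) (u : ATerm S) : ATerm S :=
  u.bind (Sum.elim σ fun i => .var (.inr i))

theorem exists_bound_of_finite {I : Type} [Finite I] (f : I → ℕ) : ∃ N, ∀ i, f i ≤ N := by
  obtain ⟨N, hN⟩ := (Set.finite_range f).bddAbove
  exact ⟨N, fun i => hN ⟨i, rfl⟩⟩

/-- `N` lies above every integer variable of `u` and is chosen before `σ`. Thus `ι` may assign
arbitrary tuples to larger integer variables, which `σ` may use as codes. -/
theorem exists_evalA_substA (u : ATerm S) : ∃ N : ℕ, ∀ (J : Interp S) (σ : Var S → ATerm S)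
    (m m' : Mem S) (ι ι' : IntVar → List ℤ), (∀ i < N, ι i = ι' i) →
    (∀ z, m' z = evalA J m ι (σ z)) → evalA J m ι (substA σ u) = evalA J m' ι' u := by
  induction u with
  | var v =>
    cases v with
    | inl z => exact ⟨0, fun J σ m m' ι ι' _ h => (h z).symm⟩
    | inr i =>
      refine ⟨i + 1, fun J σ m m' ι ι' h _ => ?_⟩
      change some (ofTuple (ι i)) = some (ofTuple (ι' i))
      rw [h i (Nat.lt_succ_self i)]
  | app f args ih =>
    choose n hn using ih
    obtain ⟨N, hN⟩ := exists_bound_of_finite n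
    refine ⟨N, fun J σ m m' ι ι' h h' => ?_⟩
    change J.sym f _ = J.sym f _
    congr 1
    funext j
    exact hn j J σ m m' ι ι' (fun i hi => h i (hi.trans_le (hN j))) h'

/-- The formula `f_A(u) ⋈ ε` with `ε ∈ [0, 1]`. -/
def tauFml (A : S.Test) (u ε : ATerm S) (r : Cmp) : BaseFml S :=
  .and (.and (.eq (tLe (tReal 0) ε) (tBool true)) (.eq (tLe ε (tReal 1)) (tBool true))) <|
    match r with
    | .eq => .eq (tTest A u) ε
    | .le => .eq (tLe (tTest A u) ε) (tBool true)
    | .ge => .eq (tLe ε (tTest A u)) (tBool true)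
    | .lt => .eq (tLe ε (tTest A u)) (tBool false)
    | .gt => .eq (tLe (tTest A u) ε) (tBool false)

theorem leVal_eq_some {a b : Val S} {o : Data S.Other} (h : leVal a b = some o) :
    (∃ p q : ℤ, a = some (.int p) ∧ b = some (.int q)) ∨
      ∃ p q : ℝ, a = some (.real p) ∧ b = some (.real q) := by
  unfold leVal at h
  split at h
  · exact .inl ⟨_, _, rfl, rfl⟩
  · exact .inr ⟨_, _, rfl, rfl⟩
  · cases h

theorem leVal_real (a b : ℝ) [Decidable (a ≤ b)] :
    leVal (some (.real a) : Val S) (some (.real b)) = some (.bool (decide (a ≤ b))) := by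
  simp only [leVal]
  congr

theorem leVal_int (a b : ℤ) :
    leVal (some (.int a) : Val S) (some (.int b)) = some (.bool (decide (a ≤ b))) := by
  simp only [leVal]

/-- Comparison is undefined on mixed types, so the bounds by real constants force `ε` to be real,
and definedness of the test symbol forces `u` to be a dataset. Strict inequalities are expressed by
a comparison with value `false` instead of a negation, so that undefined arguments still falsify
them. This formula is needed because the atom `tau` takes a variable, for which a term cannot be
substituted. -/
theorem satBase_tauFml {J : Interp S} (M : Model J) (ι : IntVar → List ℤ) (w : World S)
    (A : S.Test) (u ε : ATerm S) (r : Cmp) :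
    M.satBase ι w (tauFml A u ε r) ↔ ∃ (δ : Dataset S) (x : ℝ),
      evalA J w.cur.mem ι u = some (ofDataset δ) ∧ evalA J w.cur.mem ι ε = some (.real x) ∧
      0 ≤ x ∧ x ≤ 1 ∧ r.holds ((J.test A).pValue δ) x := by
  classical
  unfold tauFml
  simp only [Model.satBase, evalA, eval_tLe, eval_tReal, eval_tBool]
  generalize hE : ε.eval J _ = E
  generalize hU : u.eval J _ = U
  constructor
  · rintro ⟨⟨⟨o, h₀, h₀'⟩, ⟨o', h₁, h₁'⟩⟩, h⟩
    obtain ⟨x, rfl⟩ : ∃ x : ℝ, E = some (.real x) := by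
      rcases leVal_eq_some h₀ with ⟨p, q, hp, hq⟩ | ⟨p, q, hp, hq⟩
      · cases hp
      · exact ⟨q, hq⟩
    obtain ⟨δ, hδ⟩ : ∃ δ : Dataset S, U = some (ofDataset δ) := by
      have key : ∃ o, J.testVal A U = some o := by
        cases r <;> simp only [Model.satBase, evalA, eval_tLe, eval_tTest, hE, hU] at h <;>
          obtain ⟨o, ho, -⟩ := h
        · exact ⟨_, ho⟩
        all_goals
          rcases leVal_eq_some ho with ⟨p, q, hp, hq⟩ | ⟨p, q, hp, hq⟩ <;>
          first | exact ⟨_, hp⟩ | exact ⟨_, hq⟩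
      obtain ⟨o, ho⟩ := key
      obtain ⟨d, hd, -⟩ := Interp.testVal_eq_some ho
      exact ⟨d, hd⟩
    refine ⟨δ, x, hδ, rfl, ?_, ?_, ?_⟩
    · rw [leVal_real, ← h₀'] at h₀
      simpa using h₀
    · rw [leVal_real, ← h₁'] at h₁
      simpa using h₁
    · cases r <;> simp only [Model.satBase, evalA, eval_tLe, eval_tTest, hE, hU, hδ,
          Interp.testVal_ofDataset, leVal_real, eval_tBool] at h <;>
        obtain ⟨o, h, h'⟩ := h <;> rw [← h'] at h <;> simpa [Cmp.holds] using h
  · rintro ⟨δ, x, rfl, rfl, h₀, h₁, h⟩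
    refine ⟨⟨⟨.bool true, ?_, rfl⟩, ⟨.bool true, ?_, rfl⟩⟩, ?_⟩
    · rw [leVal_real]
      simpa using h₀
    · rw [leVal_real]
      simpa using h₁
    · cases r <;> simp only [Model.satBase, evalA, eval_tLe, eval_tTest, hE, hU,
          Interp.testVal_ofDataset, leVal_real, eval_tBool] <;>
        refine ⟨_, ?_, rfl⟩ <;> simpa [Cmp.holds] using h

/-- Atoms reduce to substitution in terms, as commands affect neither samplings nor predicates. For
the modality, `Simulates` is inherited by every world indistinguishable from `w`, and the two halves
of the matching show that these worlds lead exactly to those indistinguishable from `w'`. -/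
theorem BaseFml.exists_subst (J : Interp S) (ψ : BaseFml S) : ∃ N : ℕ, ∀ σ : Var S → ATerm S,
    ∃ ψ' : BaseFml S, ∀ (M : Model J) (ι ι' : IntVar → List ℤ) (w w' : World S),
      (∀ i < N, ι i = ι' i) → M.Simulates σ ι w w' →
        (M.satBase ι w ψ' ↔ M.satBase ι' w' ψ) := by
  have key : ∀ {M : Model J} {σ : Var S → ATerm S} {ι : IntVar → List ℤ} {w w' : World S},
      M.Simulates σ ι w w' → ∀ z, w'.cur.mem z = evalA J w.cur.mem ι (σ z) := by
    rintro M σ ι w w' ⟨ls, h, hw, h'⟩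
    exact h' w w' hw rfl h
  induction ψ with
  | eq u v =>
    obtain ⟨a, ha⟩ := exists_evalA_substA u
    obtain ⟨b, hb⟩ := exists_evalA_substA v
    refine ⟨max a b, fun σ => ⟨.eq (substA σ u) (substA σ v), fun M ι ι' w w' h hs => ?_⟩⟩
    simp only [Model.satBase]
    rw [ha J σ _ _ _ _ (fun i hi => h i (lt_max_of_lt_left hi)) (key hs),
      hb J σ _ _ _ _ (fun i hi => h i (lt_max_of_lt_right hi)) (key hs)]
  | sampledN d D n =>
    obtain ⟨a, ha⟩ := exists_evalA_substA d
    obtain ⟨b, hb⟩ := exists_evalA_substA D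
    obtain ⟨c, hc⟩ := exists_evalA_substA n
    refine ⟨max (max a b) c, fun σ => ⟨.sampledN (substA σ d) (substA σ D) (substA σ n),
      fun M ι ι' w w' h hs => ?_⟩⟩
    simp only [Model.satBase]
    rw [ha J σ _ _ _ _ (fun i hi => h i (lt_max_of_lt_left (lt_max_of_lt_left hi))) (key hs),
      hb J σ _ _ _ _ (fun i hi => h i (lt_max_of_lt_left (lt_max_of_lt_right hi))) (key hs),
      hc J σ _ _ _ _ (fun i hi => h i (lt_max_of_lt_right hi)) (key hs)]
    obtain ⟨ls, he, -⟩ := hs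
    simp only [he.hasSampling_iff]
  | sampled d D =>
    obtain ⟨a, ha⟩ := exists_evalA_substA d
    obtain ⟨b, hb⟩ := exists_evalA_substA D
    refine ⟨max a b, fun σ => ⟨.sampled (substA σ d) (substA σ D),
      fun M ι ι' w w' h hs => ?_⟩⟩
    simp only [Model.satBase]
    rw [ha J σ _ _ _ _ (fun i hi => h i (lt_max_of_lt_left hi)) (key hs),
      hb J σ _ _ _ _ (fun i hi => h i (lt_max_of_lt_right hi)) (key hs)]
    obtain ⟨ls, he, -⟩ := hs
    simp only [he.hasSampling_iff]
  | tau r y A ε =>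
    obtain ⟨a, ha⟩ := exists_evalA_substA ε
    refine ⟨a, fun σ => ⟨tauFml A (σ y) (substA σ ε) r, fun M ι ι' w w' h hs => ?_⟩⟩
    rw [satBase_tauFml, ha J σ _ _ _ _ h (key hs), ← key hs y]
    rfl
  | rel R args =>
    choose n hn using fun j => exists_evalA_substA (args j)
    obtain ⟨N, hN⟩ := exists_bound_of_finite n
    refine ⟨N, fun σ => ⟨.rel R fun j => substA σ (args j), fun M ι ι' w w' h hs => ?_⟩⟩
    simp only [Model.satBase]
    have : ∀ j, evalA J w.cur.mem ι (substA σ (args j)) = evalA J w'.cur.mem ι' (args j) :=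
      fun j => hn j J σ _ _ _ _ (fun i hi => h i (hi.trans_le (hN j))) (key hs)
    simp only [this]
    obtain ⟨ls, he, hw, -⟩ := hs
    rw [Model.exec_val_eq he hw]
  | neg ψ ih =>
    obtain ⟨N, ih⟩ := ih
    refine ⟨N, fun σ => ?_⟩
    obtain ⟨ψ', h'⟩ := ih σ
    exact ⟨.neg ψ', fun M ι ι' w w' h hs => not_congr (h' M ι ι' w w' h hs)⟩
  | and ψ χ ih₁ ih₂ =>
    obtain ⟨a, ha⟩ := ih₁
    obtain ⟨b, hb⟩ := ih₂
    refine ⟨max a b, fun σ => ?_⟩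
    obtain ⟨ψ', h₁⟩ := ha σ
    obtain ⟨χ', h₂⟩ := hb σ
    exact ⟨.and ψ' χ', fun M ι ι' w w' h hs => and_congr
      (h₁ M ι ι' w w' (fun i hi => h i (lt_max_of_lt_left hi)) hs)
      (h₂ M ι ι' w w' (fun i hi => h i (lt_max_of_lt_right hi)) hs)⟩
  | know ψ ih =>
    obtain ⟨N, ih⟩ := ih
    refine ⟨N, fun σ => ?_⟩
    obtain ⟨ψ', h'⟩ := ih σ
    refine ⟨.know ψ', fun M ι ι' w w' h hs => ?_⟩
    obtain ⟨ls, he, hw, hu⟩ := hs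
    have hsim : ∀ u u', u ∈ M.worlds → w.observe = u.observe → Exec J ls u u' →
        M.Simulates σ ι u u' := fun u u' hm hwu hex =>
      ⟨ls, hex, hm, fun t t' ht hut htt => hu t t' ht (hwu.trans hut) htt⟩
    constructor
    · intro H u' hu' hwu'
      obtain ⟨u, hm, hwu, hex⟩ := Model.exists_exec_of_observe_eq' he hu' hwu'
      exact (h' M ι ι' u u' h (hsim u u' hm hwu hex)).1 (H u hm hwu)
    · intro H u hm hwu
      obtain ⟨u', hex, hwu'⟩ := Model.exists_exec_of_observe_eq he hwu
      exact (h' M ι ι' u u' h (hsim u u' hm hwu hex)).2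
        (H u' (Model.exec_mem hex hm) hwu')

/-- The hypothesis on `σ` says that its terms depend on integer variables from `N` upwards only; it
prevents their capture by the quantifiers of the formula. -/
theorem Fml.exists_subst (J : Interp S) (φ : Fml S) : ∃ N : ℕ, ∀ σ : Var S → ATerm S,
    (∀ (z : Var S) (m : Mem S) (ι ι' : IntVar → List ℤ), (∀ i, N ≤ i → ι i = ι' i) →
      evalA J m ι (σ z) = evalA J m ι' (σ z)) →
    ∃ φ' : Fml S, ∀ (M : Model J) (ι ι' : IntVar → List ℤ) (w w' : World S),
      (∀ i < N, ι i = ι' i) → M.Simulates σ ι w w' → (M.sat ι w φ' ↔ M.sat ι' w' φ) := by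
  induction φ with
  | base ψ =>
    obtain ⟨N, h⟩ := ψ.exists_subst J
    refine ⟨N, fun σ _ => ?_⟩
    obtain ⟨ψ', h'⟩ := h σ
    exact ⟨.base ψ', h'⟩
  | neg φ ih =>
    obtain ⟨N, ih⟩ := ih
    refine ⟨N, fun σ hσ => ?_⟩
    obtain ⟨φ', h'⟩ := ih σ hσ
    exact ⟨.neg φ', fun M ι ι' w w' h hs => not_congr (h' M ι ι' w w' h hs)⟩
  | and φ χ ih₁ ih₂ =>
    obtain ⟨a, ha⟩ := ih₁
    obtain ⟨b, hb⟩ := ih₂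
    refine ⟨max a b, fun σ hσ => ?_⟩
    obtain ⟨φ', h₁⟩ := ha σ fun z m ι ι' h =>
      hσ z m ι ι' fun i hi => h i ((le_max_left a b).trans hi)
    obtain ⟨χ', h₂⟩ := hb σ fun z m ι ι' h =>
      hσ z m ι ι' fun i hi => h i ((le_max_right a b).trans hi)
    exact ⟨.and φ' χ', fun M ι ι' w w' h hs => and_congr
      (h₁ M ι ι' w w' (fun i hi => h i (lt_max_of_lt_left hi)) hs)
      (h₂ M ι ι' w w' (fun i hi => h i (lt_max_of_lt_right hi)) hs)⟩
  | all i φ ih =>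
    obtain ⟨N, ih⟩ := ih
    -- The bound also exceeds the quantified variable `i`, so updating `i` does not change the
    -- values of `σ`.
    refine ⟨max N (i + 1), fun σ hσ => ?_⟩
    obtain ⟨φ', h'⟩ := ih σ fun z m ι ι' h =>
      hσ z m ι ι' fun j hj => h j ((le_max_left N (i + 1)).trans hj)
    refine ⟨.all i φ', fun M ι ι' w w' h hs => forall_congr' fun t => ?_⟩
    refine h' M _ _ w w' (fun j hj => ?_) ?_
    · by_cases hji : j = i
      · simp [hji]
      · simpa [hji] using h j (lt_max_of_lt_left hj)
    · obtain ⟨ls, he, hw, hu⟩ := hs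
      refine ⟨ls, he, hw, fun u u' hm hwu hex z => ?_⟩
      rw [hu u u' hm hwu hex z]
      refine hσ z _ _ _ fun j hj => ?_
      rw [Function.update_of_ne]
      exact (Nat.lt_of_succ_le ((le_max_right N (i + 1)).trans hj)).ne'

/-! ## Weakest preconditions of loop-free programs -/

/-- Program terms as assertion terms. -/
def PTerm.toA (e : PTerm S) : ATerm S := Term.bind (fun x => .var (.inl (.obs x))) e

theorem evalA_toA (J : Interp S) (w : World S) (ι : IntVar → List ℤ) (e : PTerm S) :
    evalA J w.cur.mem ι e.toA = e.eval J w.obs := by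
  unfold evalA PTerm.toA
  rw [Term.eval_bind]
  rfl

/-- The effect of one label is a substitution free of integer variables; the weakest precondition is
the implication from executability to the substituted formula. -/
theorem Fml.exists_wp_lbl (J : Interp S) (l : Lbl S) (φ : Fml S) : ∃ F : Fml S,
    ∀ (M : Model J) (ι : IntVar → List ℤ) (w : World S), w ∈ M.worlds →
      (M.sat ι w F ↔ ∀ w', l.Step J w w' → M.sat ι w' φ) := by
  obtain ⟨N, h⟩ := φ.exists_subst J
  obtain ⟨φ', h'⟩ := h
    (fun
      | .obs x => PTerm.toA (l.tm x)
      | .inv z => .var (.inl (.inv z))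
      | .hist y A => tAdd (.var (.inl (.hist y A))) (tInt (l.cnt y A))) (by
    intro z m ι ι' _
    cases z with
    | obs x =>
      unfold PTerm.toA evalA
      rw [Term.eval_bind, Term.eval_bind]
      rfl
    | inv z => rfl
    | hist y A => rfl)
  refine ⟨.neg (.and (.base (.eq (PTerm.toA l.lhs) (PTerm.toA l.rhs))) (.neg φ')),
    fun M ι w hw => ?_⟩
  simp only [Model.sat, Model.satBase, evalA_toA, not_and, not_not]
  have key : ∀ w', l.Step J w w' → (M.sat ι w φ' ↔ M.sat ι w' φ) := fun w' hs =>
    h' M ι ι w w' (fun _ _ => rfl) <| Model.simulates_of_exec (ls := [l]) ⟨w', hs, rfl⟩ hw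
      (fun u hu x => by rw [hs.spec.2.1, ← hu]; exact evalA_toA J u ι _) (fun _ => rfl)
      (fun y A m => by simp [evalA, cnts])
  constructor
  · intro H w' hs
    exact (key w' hs).1 (H hs.spec.1)
  · intro H hok
    obtain ⟨w', hs⟩ := Lbl.exists_step (l := l) (w := w) hok
    exact (key w' hs).2 (H w' hs)

theorem Fml.exists_forall_mem (J : Interp S) {I : Type} (L : List I)
    (P : (M : Model J) → (IntVar → List ℤ) → World S → I → Prop)
    (h : ∀ i ∈ L, ∃ F : Fml S, ∀ (M : Model J) ι, ∀ w ∈ M.worlds,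
      (M.sat ι w F ↔ P M ι w i)) :
    ∃ F : Fml S, ∀ (M : Model J) ι, ∀ w ∈ M.worlds, (M.sat ι w F ↔ ∀ i ∈ L, P M ι w i) := by
  induction L with
  | nil =>
    exact ⟨.base (.eq (tInt 0) (tInt 0)), fun M ι w _ => by simp [Model.sat, Model.satBase, evalA]⟩
  | cons i L ih =>
    obtain ⟨F, hF⟩ := ih fun j hj => h j (List.mem_cons_of_mem _ hj)
    obtain ⟨G, hG⟩ := h i List.mem_cons_self
    exact ⟨.and G F, fun M ι w hw => by simp [Model.sat, hF M ι w hw, hG M ι w hw]⟩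

/-- Conjunction over the finitely many first steps, each contributing the precondition of its label
for the formula that recursion gives for the smaller residual program. Interleaving is already
contained in the list of first steps. -/
theorem Fml.exists_wp_of_not_hasLoop (J : Interp S) (φ : Fml S) (C : Prog S)
    (hC : ¬ C.HasLoop) : ∃ F : Fml S, ∀ (M : Model J) ι, ∀ w ∈ M.worlds,
      (M.sat ι w F ↔ ∀ w' ∈ C.sem J w, M.sat ι w' φ) := by
  induction hn : C.size using Nat.strong_induction_on generalizing C with
  | _ n ih =>
    obtain ⟨F, hF⟩ := exists_forall_mem J C.next
      (fun M ι w p => ∀ w₁, p.1.Step J w w₁ →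
        ∀ w', (p.2.elim (w' = w₁) fun C' => w' ∈ C'.sem J w₁) → M.sat ι w' φ) (by
      rintro ⟨l, r⟩ hm
      cases r with
      | none =>
        obtain ⟨F, hF⟩ := exists_wp_lbl J l φ
        refine ⟨F, fun M ι w hw => (hF M ι w hw).trans ?_⟩
        simp
      | some C' =>
        obtain ⟨h₁, h₂⟩ := C.size_of_mem_next hC hm
        obtain ⟨G, hG⟩ := ih _ (hn ▸ h₂) C' h₁ rfl
        obtain ⟨F, hF⟩ := exists_wp_lbl J l G
        refine ⟨F, fun M ι w hw => (hF M ι w hw).trans ?_⟩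
        exact forall_congr' fun w₁ => forall_congr' fun hs =>
          hG M ι w₁ (Model.step_mem hs hw))
    refine ⟨F, fun M ι w hw => (hF M ι w hw).trans ?_⟩
    constructor
    · intro H w' hw'
      obtain ⟨l, r, w₁, hm, hs, h⟩ := Prog.mem_sem_iff.1 hw'
      exact H (l, r) hm w₁ hs w' h
    · rintro H ⟨l, r⟩ hm w₁ hs w' h
      exact H w' (Prog.mem_sem_iff.2 ⟨l, r, w₁, hm, hs, h⟩)

/-! ## Definable relations between integer tuples -/

theorem exists_injective_ge (I : Type) [Finite I] (N : ℕ) :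
    ∃ h : I → IntVar, Function.Injective h ∧ ∀ i, N ≤ h i := by
  obtain ⟨e, he⟩ := exists_injective_nat I
  exact ⟨fun i => N + e i, fun i j hij => he (Nat.add_left_cancel hij),
    fun i => Nat.le_add_right _ _⟩

theorem Fml.exists_forall_list (F : Fml S) (l : List IntVar) : ∃ F' : Fml S,
    ∀ {J : Interp S} (M : Model J) ι w, M.sat ι w F' ↔
      ∀ ι' : IntVar → List ℤ, (∀ i ∉ l, ι' i = ι i) → M.sat ι' w F := by
  induction l with
  | nil =>
    refine ⟨F, fun M ι w => ⟨fun h ι' h' => ?_, fun h => h ι fun _ _ => rfl⟩⟩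
    rwa [show ι' = ι from funext fun i => h' i List.not_mem_nil]
  | cons i l ih =>
    obtain ⟨G, hG⟩ := ih
    refine ⟨.all i G, fun M ι w => ?_⟩
    simp only [Model.sat, hG]
    constructor
    · intro h ι' h'
      refine h (ι' i) ι' fun j hj => ?_
      by_cases hji : j = i
      · simp [hji]
      · simpa [hji] using h' j (by simp [hji, hj])
    · intro h t ι' h'
      refine h ι' fun j hj => ?_
      simp only [List.mem_cons, not_or] at hj
      simpa [hj.1] using h' j hj.2

/-- Quantification over a finite family of tuples. -/
theorem Fml.exists_forall_extend {I : Type} [Finite I] {h : I → IntVar}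
    (hh : Function.Injective h) (F : Fml S) : ∃ F' : Fml S,
    ∀ {J : Interp S} (M : Model J) ι w, M.sat ι w F' ↔
      ∀ s : I → List ℤ, M.sat (Function.extend h s ι) w F := by
  obtain ⟨F', hF⟩ := F.exists_forall_list (Set.finite_range h).toFinset.toList
  refine ⟨F', fun M ι w => (hF M ι w).trans ?_⟩
  simp only [Finset.mem_toList, Set.Finite.mem_toFinset, Set.mem_range]
  constructor
  · intro H s
    exact H _ fun i hi => Function.extend_apply' _ _ _ hi
  · intro H ι' h'
    convert H (fun i => ι' (h i)) using 1
    funext n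
    by_cases hn : ∃ i, h i = n
    · obtain ⟨i, rfl⟩ := hn
      rw [hh.extend_apply]
    · rw [Function.extend_apply' _ _ _ hn, h' n hn]

/-- A relation between the values of the observable variables and a family of tuples is definable
if it is expressed by a formula, for every choice of integer variables for the family. -/
def Dfn (J : Interp S) (V : Type) (P : (S.Obs → Val S) → (V → List ℤ) → Prop) : Prop :=
  ∀ g : V → IntVar, ∃ F : Fml S, ∀ (M : Model J) ι, ∀ w ∈ M.worlds,
    (M.sat ι w F ↔ P w.obs fun v => ι (g v))

/-- A function of the values of the observable variables and a family of tuples is definable if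
it is expressed by a term. -/
def TDfn (J : Interp S) (V : Type) (f : (S.Obs → Val S) → (V → List ℤ) → Val S) : Prop :=
  ∃ u : Term S (S.Obs ⊕ V), ∀ x a,
    u.eval J (Sum.elim x fun v => some (ofTuple (a v))) = f x a

variable {J : Interp S} {V W : Type}

namespace TDfn

theorem obs (y : S.Obs) : TDfn J V fun x _ => x y := ⟨.var (.inl y), fun _ _ => rfl⟩

theorem tuple (v : V) : TDfn J V fun _ a => some (ofTuple (a v)) :=
  ⟨.var (.inr v), fun _ _ => rfl⟩

theorem bool (b : Bool) : TDfn J V fun _ _ => some (.bool b) := ⟨tBool b, fun _ _ => rfl⟩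

theorem int (z : ℤ) : TDfn J V fun _ _ => some (.int z) := ⟨tInt z, fun _ _ => rfl⟩

variable {f g : (S.Obs → Val S) → (V → List ℤ) → Val S}

theorem add (hf : TDfn J V f) (hg : TDfn J V g) : TDfn J V fun x a => addVal (f x a) (g x a) := by
  obtain ⟨u, hu⟩ := hf
  obtain ⟨v, hv⟩ := hg
  exact ⟨tAdd u v, fun x a => by rw [eval_tAdd, hu, hv]⟩

theorem le (hf : TDfn J V f) (hg : TDfn J V g) : TDfn J V fun x a => leVal (f x a) (g x a) := by
  obtain ⟨u, hu⟩ := hf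
  obtain ⟨v, hv⟩ := hg
  exact ⟨tLe u v, fun x a => by rw [eval_tLe, hu, hv]⟩

theorem nth (hf : TDfn J V f) (hg : TDfn J V g) : TDfn J V fun x a => nthVal (f x a) (g x a) := by
  obtain ⟨u, hu⟩ := hf
  obtain ⟨v, hv⟩ := hg
  exact ⟨tNth u v, fun x a => by rw [eval_tNth, hu, hv]⟩

theorem length (v : V) : TDfn J V fun _ a => some (.int (a v).length) :=
  ⟨tLen (.var (.inr v)), fun _ a => by simp [ofTuple, lenVal]⟩

theorem eval {U : Type} (e : Term S U) {f : U → (S.Obs → Val S) → (V → List ℤ) → Val S}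
    (hf : ∀ z, TDfn J V (f z)) : TDfn J V fun x a => e.eval J fun z => f z x a := by
  choose u hu using hf
  exact ⟨e.bind u, fun x a => by simp only [Term.eval_bind, hu]⟩

theorem rename (hf : TDfn J V f) (r : V → W) : TDfn J W fun x a => f x fun v => a (r v) := by
  obtain ⟨u, hu⟩ := hf
  refine ⟨u.bind fun z => .var (Sum.map id r z), fun x a => ?_⟩
  refine Eq.trans ?_ (hu x fun v => a (r v))
  rw [Term.eval_bind]
  congr 1
  funext z
  cases z <;> rfl

end TDfn

namespace Dfn

variable {P Q : (S.Obs → Val S) → (V → List ℤ) → Prop}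

theorem congr (hP : Dfn J V P) (h : ∀ x a, Q x a ↔ P x a) : Dfn J V Q := by
  rwa [show Q = P from funext fun x => funext fun a => propext (h x a)]

/-- Composition suffices because `Dfn` admits non-injective choices of integer variables. -/
theorem rename (hP : Dfn J V P) (r : V → W) : Dfn J W fun x a => P x fun v => a (r v) :=
  fun g => hP (g ∘ r)

theorem not (hP : Dfn J V P) : Dfn J V fun x a => ¬ P x a := by
  intro g
  obtain ⟨F, hF⟩ := hP g
  exact ⟨.neg F, fun M ι w hw => not_congr (hF M ι w hw)⟩

theorem and (hP : Dfn J V P) (hQ : Dfn J V Q) : Dfn J V fun x a => P x a ∧ Q x a := by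
  intro g
  obtain ⟨F, hF⟩ := hP g
  obtain ⟨G, hG⟩ := hQ g
  exact ⟨.and F G, fun M ι w hw => and_congr (hF M ι w hw) (hG M ι w hw)⟩

theorem or (hP : Dfn J V P) (hQ : Dfn J V Q) : Dfn J V fun x a => P x a ∨ Q x a :=
  (hP.not.and hQ.not).not.congr fun _ _ => by tauto

theorem imp (hP : Dfn J V P) (hQ : Dfn J V Q) : Dfn J V fun x a => P x a → Q x a :=
  (hP.and hQ.not).not.congr fun _ _ => by tauto

theorem eq_some {f g : (S.Obs → Val S) → (V → List ℤ) → Val S} (hf : TDfn J V f)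
    (hg : TDfn J V g) : Dfn J V fun x a => ∃ o, f x a = some o ∧ g x a = some o := by
  intro h
  obtain ⟨u, hu⟩ := hf
  obtain ⟨v, hv⟩ := hg
  let σ : S.Obs ⊕ V → ATerm S :=
    Sum.elim (fun y => .var (.inl (.obs y))) fun v => .var (.inr (h v))
  have key : ∀ (ι : IntVar → List ℤ) (w : World S) (t : Term S (S.Obs ⊕ V)),
      evalA J w.cur.mem ι (t.bind σ) =
        t.eval J (Sum.elim w.obs fun v => some (ofTuple (ι (h v)))) := by
    intro ι w t
    rw [evalA, Term.eval_bind]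
    congr 1
    funext z
    cases z <;> rfl
  exact ⟨.base (.eq (u.bind σ) (v.bind σ)), fun M ι w hw => by
    simp only [Model.sat, Model.satBase, key, hu, hv]⟩

theorem eq {f g : (S.Obs → Val S) → (V → List ℤ) → Val S} (hf : TDfn J V f)
    (hg : TDfn J V g) : Dfn J V fun x a => f x a = g x a := by
  -- Either both values are defined and equal, or both are undefined; a value is undefined exactly
  -- when it fails to be `eq` to itself.
  refine ((eq_some hf hg).or ((eq_some hf hf).not.and (eq_some hg hg).not)).congr fun x a => ?_
  cases f x a <;> cases g x a <;> simp [_root_.eq_comm]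

theorem const (p : Prop) : Dfn J V fun _ _ => p := by
  by_cases h : p
  · exact (eq (TDfn.int 0) (TDfn.int 0)).congr fun _ _ => by simp [h]
  · exact (eq (TDfn.int 0) (TDfn.int 0)).not.congr fun _ _ => by simp [h]

theorem forall_mem {I : Type} (L : List I) {P : I → (S.Obs → Val S) → (V → List ℤ) → Prop}
    (hP : ∀ i, Dfn J V (P i)) : Dfn J V fun x a => ∀ i ∈ L, P i x a := by
  induction L with
  | nil => exact (const True).congr fun _ _ => by simp
  | cons i L ih => exact ((hP i).and ih).congr fun _ _ => by simp

theorem exists_mem {I : Type} (L : List I) {P : I → (S.Obs → Val S) → (V → List ℤ) → Prop}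
    (hP : ∀ i, Dfn J V (P i)) : Dfn J V fun x a => ∃ i ∈ L, P i x a :=
  (forall_mem L fun i => (hP i).not).not.congr fun _ _ => by push Not; rfl

theorem forall_finite {I : Type} [Finite I] {P : I → (S.Obs → Val S) → (V → List ℤ) → Prop}
    (hP : ∀ i, Dfn J V (P i)) : Dfn J V fun x a => ∀ i, P i x a :=
  (forall_mem (Set.finite_univ (α := I)).toFinset.toList hP).congr fun _ _ => by simp

theorem forall_family {I : Type} [Finite I] [Finite V]
    {P : (S.Obs → Val S) → (I → List ℤ) → (V → List ℤ) → Prop}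
    (hP : Dfn J (I ⊕ V) fun x a => P x (fun i => a (.inl i)) fun v => a (.inr v)) :
    Dfn J V fun x a => ∀ s, P x s a := by
  intro g
  obtain ⟨N, hN⟩ := exists_bound_of_finite g
  -- Starting at `N + 1` makes the quantified variables disjoint from the range of `g`.
  obtain ⟨h, hh, hhN⟩ := exists_injective_ge I (N + 1)
  obtain ⟨F, hF⟩ := hP (Sum.elim h g)
  obtain ⟨F', hF'⟩ := F.exists_forall_extend hh
  refine ⟨F', fun M ι w hw => (hF' M ι w).trans (forall_congr' fun s => ?_)⟩
  rw [hF M _ w hw]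
  have h₁ : (fun i => Function.extend h s ι (h i)) = s := funext fun i => hh.extend_apply _ _ i
  have h₂ : (fun v => Function.extend h s ι (g v)) = fun v => ι (g v) := funext fun v => by
    refine Function.extend_apply' _ _ _ ?_
    rintro ⟨i, hi⟩
    have := hN v
    have := hhN i
    rw [hi] at this
    exact absurd (hN v) (Nat.not_le_of_lt this)
  simp only [Sum.elim_inl, Sum.elim_inr, h₁, h₂]

theorem exists_family {I : Type} [Finite I] [Finite V]
    {P : (S.Obs → Val S) → (I → List ℤ) → (V → List ℤ) → Prop}
    (hP : Dfn J (I ⊕ V) fun x a => P x (fun i => a (.inl i)) fun v => a (.inr v)) :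
    Dfn J V fun x a => ∃ s, P x s a :=
  (forall_family (P := fun x s a => ¬ P x s a) hP.not).not.congr fun _ _ => by push Not; rfl

theorem forall_tuple [Finite V] {P : (S.Obs → Val S) → List ℤ → (V → List ℤ) → Prop}
    (hP : Dfn J (Unit ⊕ V) fun x a => P x (a (.inl ())) fun v => a (.inr v)) :
    Dfn J V fun x a => ∀ t, P x t a :=
  (forall_family (I := Unit) (P := fun x s a => P x (s ()) a) hP).congr fun _ _ =>
    ⟨fun h s => h (s ()), fun h t => h fun _ => t⟩

theorem exists_tuple [Finite V] {P : (S.Obs → Val S) → List ℤ → (V → List ℤ) → Prop}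
    (hP : Dfn J (Unit ⊕ V) fun x a => P x (a (.inl ())) fun v => a (.inr v)) :
    Dfn J V fun x a => ∃ t, P x t a :=
  (forall_tuple (P := fun x t a => ¬ P x t a) hP.not).not.congr fun _ _ => by push Not; rfl

/-- From here on, natural numbers are represented by lengths of tuples. Every tuple then denotes a
number, so quantifiers over numbers need no relativization. -/
theorem length_lt (u v : V) : Dfn J V fun _ a => (a u).length < (a v).length :=
  (eq (((TDfn.length u).add (TDfn.int 1)).le (TDfn.length v)) (TDfn.bool true)).congr
    fun _ a => by
      simp only [addVal_int, leVal_int, Option.some.injEq, Data.bool.injEq, decide_eq_true_eq]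
      omega

theorem length_eq_add (u v : V) (n : ℕ) : Dfn J V fun _ a => (a u).length = (a v).length + n :=
  (eq (TDfn.length u) ((TDfn.length v).add (TDfn.int n))).congr fun _ a => by
    simp only [addVal_int, Option.some.injEq, Data.int.injEq]
    omega

theorem length_eq (u : V) (n : ℕ) : Dfn J V fun _ a => (a u).length = n :=
  (eq (TDfn.length u) (TDfn.int n)).congr fun _ a => by
    simp only [Option.some.injEq, Data.int.injEq, Nat.cast_inj]

/-- A finite disjunction over the indices of `L`; every index beyond the end represents `none`,
which will stand for a finished program. -/
theorem getElem?_length_eq {α : Type} (L : List α) (r : Option α) (u : V) :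
    Dfn J V fun _ a => L[(a u).length]? = r := by
  refine ((exists_mem (List.range L.length)
    fun i => (length_eq (J := J) u i).and (const (L[i]? = r))).or
    ((const (r = none)).and (forall_mem (List.range L.length) fun i => (length_eq u i).not))).congr
    fun x a => ?_
  simp only [List.mem_range]
  by_cases h : (a u).length < L.length
  · constructor
    · intro h'
      exact .inl ⟨_, h, rfl, h'⟩
    · rintro (⟨i, -, hi, h'⟩ | ⟨-, h'⟩)
      · rwa [hi]
      · exact (h' _ h rfl).elim
  · rw [List.getElem?_eq_none (not_lt.1 h)]
    constructor
    · rintro rfl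
      exact .inr ⟨rfl, fun i hi hi' => h (hi' ▸ hi)⟩
    · rintro (⟨i, hi, hi', -⟩ | ⟨h', -⟩)
      · exact (h (hi' ▸ hi)).elim
      · exact h'.symm

end Dfn

/-! ## Coding of sequences of tuples -/

/-- `s` is the `k`-th element of the sequence of tuples coded by the list `O` of offsets in the
list `D`, in which every element is preceded by its length. -/
def Elem (O D : List ℤ) (k : ℕ) (s : List ℤ) : Prop :=
  ∃ p : ℕ, O[k]? = some (p : ℤ) ∧ D[p]? = some (s.length : ℤ) ∧
    ∀ m < s.length, D[p + 1 + m]? = s[m]?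

/-- Makes the successor found at one step coincide with the tuple from which the next step starts.
-/
theorem Elem.unique {O D s s' : List ℤ} {k : ℕ} (h : Elem O D k s) (h' : Elem O D k s') :
    s = s' := by
  obtain ⟨p, h₁, h₂, h₃⟩ := h
  obtain ⟨p', h₁', h₂', h₃'⟩ := h'
  obtain rfl : p = p' := by
    rw [h₁] at h₁'
    exact_mod_cast Option.some.inj h₁'
  have hl : s.length = s'.length := by
    rw [h₂] at h₂'
    exact_mod_cast Option.some.inj h₂'
  refine List.ext_getElem? fun m => ?_
  by_cases hm : m < s.length
  · rw [← h₃ m hm, ← h₃' m (hl ▸ hm)]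
  · rw [List.getElem?_eq_none (not_lt.1 hm), List.getElem?_eq_none (hl ▸ not_lt.1 hm)]

theorem getElem?_append_of_eq_some {l l' : List ℤ} {k : ℕ} {z : ℤ} (h : l[k]? = some z) :
    (l ++ l')[k]? = some z := by
  rw [List.getElem?_append_left, h]
  exact (List.getElem?_eq_some_iff.1 h).1

theorem Elem.append {O D s : List ℤ} {k : ℕ} (h : Elem O D k s) (O' D' : List ℤ) :
    Elem (O ++ O') (D ++ D') k s := by
  obtain ⟨p, h₁, h₂, h₃⟩ := h
  refine ⟨p, getElem?_append_of_eq_some h₁, getElem?_append_of_eq_some h₂, fun m hm => ?_⟩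
  have := h₃ m hm
  rw [List.getElem?_eq_getElem hm] at this ⊢
  exact getElem?_append_of_eq_some this

/-- A new entry is appended to `D` preceded by its length, and its position, the old length of `D`,
is appended to `O`; earlier entries stay readable. -/
theorem exists_elem (f : ℕ → List ℤ) (n : ℕ) :
    ∃ O D : List ℤ, O.length = n ∧ ∀ k < n, Elem O D k (f k) := by
  induction n with
  | zero => exact ⟨[], [], rfl, by simp⟩
  | succ n ih =>
    obtain ⟨O, D, hO, h⟩ := ih
    refine ⟨O ++ [(D.length : ℤ)], D ++ ((f n).length : ℤ) :: f n, by simp [hO], fun k hk => ?_⟩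
    rcases Nat.lt_succ_iff_lt_or_eq.1 hk with hk | rfl
    · exact (h k hk).append _ _
    · refine ⟨D.length, ?_, ?_, fun m hm => ?_⟩
      · rw [List.getElem?_append_right hO.le]
        simp [hO]
      · rw [List.getElem?_append_right le_rfl]
        simp
      · rw [List.getElem?_append_right (by omega)]
        simp [show D.length + 1 + m - D.length = m + 1 by omega]

theorem nthVal_ofTuple (t : List ℤ) (k : ℕ) :
    nthVal (some (ofTuple t) : Val S) (some (.int k)) = t[k]?.map .int := by
  simp [nthVal, ofTuple]

theorem nthVal_ofTuple_eq_some {t : List ℤ} {v : Val S} {o : Data S.Other}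
    (h : nthVal (some (ofTuple t)) v = some o) :
    ∃ p : ℕ, v = some (.int p) ∧ t[p]?.map .int = some o := by
  unfold nthVal ofTuple at h
  split at h
  · rename_i xs z hx
    cases hx
    split_ifs at h with hz
    obtain ⟨p, rfl⟩ := Int.eq_ofNat_of_zero_le hz
    exact ⟨p, rfl, by simpa using h⟩
  · cases h

/-- Eliminates the offset `p`: since `nth` is defined only at nonnegative integers, the first
equation already forces the offset to be a natural number. The index `m` becomes the length of a
quantified tuple. -/
theorem elem_iff (O D : List ℤ) (k : ℕ) (s : List ℤ) : Elem O D k s ↔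
    nthVal (some (ofTuple D) : Val S) (nthVal (some (ofTuple O)) (some (.int k))) =
      some (.int s.length) ∧
    ∀ m : List ℤ, m.length < s.length →
      nthVal (some (ofTuple D) : Val S) (addVal (addVal
        (nthVal (some (ofTuple O)) (some (.int k))) (some (.int 1))) (some (.int m.length))) =
      nthVal (some (ofTuple s)) (some (.int m.length)) := by
  have hinj : Function.Injective (Option.map (Data.int : ℤ → Data S.Other)) :=
    Option.map_injective fun a b h => by injection h
  have hadd : ∀ p m : ℕ, addVal (addVal (some (.int p) : Val S) (some (.int 1)))
      (some (.int m)) = some (.int ((p + 1 + m : ℕ) : ℤ)) := by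
    intro p m
    simp
  constructor
  · rintro ⟨p, h₁, h₂, h₃⟩
    simp only [nthVal_ofTuple, h₁, Option.map_some, hadd]
    exact ⟨by rw [h₂]; rfl, fun m hm => by rw [h₃ _ hm]⟩
  · rintro ⟨h₁, h₂⟩
    obtain ⟨p, hp, hp'⟩ := nthVal_ofTuple_eq_some h₁
    rw [hp] at h₂
    rw [nthVal_ofTuple] at hp
    refine ⟨p, hinj hp, hinj hp', fun m hm => hinj ?_⟩
    have := h₂ (List.replicate m 0) (by simpa using hm)
    rw [hadd, nthVal_ofTuple, nthVal_ofTuple] at this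
    simpa using this

namespace Dfn

theorem elem [Finite V] (o d s : V) {k : (V → List ℤ) → ℕ}
    (hk : TDfn J V fun _ a => some (.int (k a))) :
    Dfn J V fun _ a => Elem (a o) (a d) (k a) (a s) := by
  refine Dfn.congr ?_ fun _ a => elem_iff (S := S) _ _ _ _
  refine and (eq ((TDfn.tuple d).nth ((TDfn.tuple o).nth hk)) (TDfn.length s)) ?_
  refine forall_tuple (imp (length_lt _ (Sum.inr s)) (eq ?_ ?_))
  · exact (TDfn.tuple (Sum.inr d)).nth
      ((((TDfn.tuple (Sum.inr o)).nth (hk.rename Sum.inr)).add (TDfn.int 1)).add (TDfn.length _))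
  · exact (TDfn.tuple (Sum.inr s)).nth (TDfn.length _)

end Dfn

theorem reflTransGen_iff_exists_seq {α : Type} {r : α → α → Prop} {a b : α} :
    Relation.ReflTransGen r a b ↔
      ∃ (n : ℕ) (f : ℕ → α), f 0 = a ∧ f n = b ∧ ∀ k < n, r (f k) (f (k + 1)) := by
  constructor
  · intro h
    induction h using Relation.ReflTransGen.head_induction_on with
    | refl => exact ⟨0, fun _ => b, rfl, rfl, by simp⟩
    | @head c d h _ ih =>
      obtain ⟨n, f, h₀, h₁, h₂⟩ := ih
      refine ⟨n + 1, fun k => k.casesOn c f, rfl, h₁, fun k hk => ?_⟩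
      cases k with
      | zero => simpa [h₀] using h
      | succ k => exact h₂ k (Nat.lt_of_succ_lt_succ hk)
  · rintro ⟨n, f, rfl, rfl, h⟩
    induction n with
    | zero => exact .refl
    | succ n ih => exact (ih fun k hk => h k (hk.trans n.lt_succ_self)).tail (h n n.lt_succ_self)

/-- Replaces the quantifier over finite sequences of families by one pair of coding tuples per
component. Conversely, uniqueness of coded entries glues the pairs of adjacent members into a single
sequence. -/
theorem reflTransGen_iff_exists_elem {I : Type} {Q : (I → List ℤ) → (I → List ℤ) → Prop}
    {a b : I → List ℤ} : Relation.ReflTransGen Q a b ↔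
      ∃ (n : List ℤ) (O D : I → List ℤ), (∀ i, Elem (O i) (D i) 0 (a i)) ∧
        (∀ i, Elem (O i) (D i) n.length (b i)) ∧ ∀ j : List ℤ, j.length < n.length →
          ∃ s s' : I → List ℤ, (∀ i, Elem (O i) (D i) j.length (s i)) ∧
            (∀ i, Elem (O i) (D i) (j.length + 1) (s' i)) ∧ Q s s' := by
  rw [reflTransGen_iff_exists_seq]
  constructor
  · rintro ⟨n, f, rfl, rfl, h⟩
    -- A path of `n` steps visits `n + 1` families.
    choose O D _ hE using fun i => exists_elem (fun k => f k i) (n + 1)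
    refine ⟨List.replicate n 0, O, D, fun i => hE i 0 n.succ_pos,
      fun i => by simpa using hE i n n.lt_succ_self, fun j hj => ?_⟩
    rw [List.length_replicate] at hj
    exact ⟨f j.length, f (j.length + 1), fun i => hE i _ (by omega), fun i => hE i _ (by omega),
      h _ hj⟩
  · rintro ⟨n, O, D, h₀, h₁, h⟩
    have h' : ∀ k < n.length, ∃ s s' : I → List ℤ, (∀ i, Elem (O i) (D i) k (s i)) ∧
        (∀ i, Elem (O i) (D i) (k + 1) (s' i)) ∧ Q s s' := fun k hk => by
      simpa using h (List.replicate k 0) (by simpa using hk)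
    have hex : ∀ k, ∃ s : I → List ℤ, k ≤ n.length → ∀ i, Elem (O i) (D i) k (s i) := by
      intro k
      rcases lt_trichotomy k n.length with hk | rfl | hk
      · obtain ⟨s, s', hs, -⟩ := h' k hk
        exact ⟨s, fun _ => hs⟩
      · exact ⟨b, fun _ => h₁⟩
      · exact ⟨b, fun hk' => absurd hk' (Nat.not_le_of_lt hk)⟩
    choose f hf using hex
    refine ⟨n.length, f, funext fun i => (hf 0 (Nat.zero_le _) i).unique (h₀ i),
      funext fun i => (hf _ le_rfl i).unique (h₁ i), fun k hk => ?_⟩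
    obtain ⟨s, s', hs, hs', hQ⟩ := h' k hk
    rwa [show f k = s from funext fun i => (hf k hk.le i).unique (hs i),
      show f (k + 1) = s' from funext fun i => (hf (k + 1) hk i).unique (hs' i)]

/-- Definable relations are closed under reflexive transitive closure. -/
theorem Dfn.reflTransGen {I : Type} [Finite I]
    {Q : (S.Obs → Val S) → (I → List ℤ) → (I → List ℤ) → Prop}
    (hQ : Dfn J (I ⊕ I) fun x a => Q x (fun i => a (.inl i)) fun i => a (.inr i)) :
    Dfn J (I ⊕ I) fun x a =>
      Relation.ReflTransGen (Q x) (fun i => a (.inl i)) fun i => a (.inr i) := by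
  refine Dfn.congr ?_ fun x a => reflTransGen_iff_exists_elem
  refine exists_tuple (exists_family (exists_family (and ?_ (and ?_ ?_))))
  · exact forall_finite fun i => elem (Sum.inr (Sum.inl i)) (Sum.inl i)
      (Sum.inr (Sum.inr (Sum.inr (Sum.inl i))))
      (k := fun _ => 0) (TDfn.int 0)
  · exact forall_finite fun i => elem (Sum.inr (Sum.inl i)) (Sum.inl i)
      (Sum.inr (Sum.inr (Sum.inr (Sum.inr i))))
      (k := fun a => (a (Sum.inr (Sum.inr (Sum.inl ())))).length) (TDfn.length _)
  · refine forall_tuple (imp (length_lt _ (Sum.inr (Sum.inr (Sum.inr (Sum.inl ()))))) ?_)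
    refine exists_family (exists_family (and ?_ (and ?_ ?_)))
    · exact forall_finite fun i => elem (Sum.inr (Sum.inr (Sum.inr (Sum.inr (Sum.inl i)))))
        (Sum.inr (Sum.inr (Sum.inr (Sum.inl i)))) (Sum.inr (Sum.inl i))
        (k := fun a => (a (Sum.inr (Sum.inr (Sum.inl ())))).length) (TDfn.length _)
    · exact forall_finite fun i => elem (Sum.inr (Sum.inr (Sum.inr (Sum.inr (Sum.inl i)))))
        (Sum.inr (Sum.inr (Sum.inr (Sum.inl i)))) (Sum.inl i)
        (k := fun a => (a (Sum.inr (Sum.inr (Sum.inl ())))).length + 1)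
        ((TDfn.length (Sum.inr (Sum.inr (Sum.inl ())))).add (TDfn.int 1))
    · exact hQ.rename (Sum.elim (fun i => Sum.inr (Sum.inl i)) fun i => Sum.inl i)

/-! ## Abstract configurations -/

variable (S) in
/-- Abstract configurations: the residual program (`none` if finished), the values of the
observable variables, and the increments of the history variables so far. -/
abbrev AConf : Type := Option (Prog S) × (S.Obs → Val S) × (S.Obs → S.Test → ℕ)

/-- Steps of abstract configurations. -/
def AStep (J : Interp S) (c c' : AConf S) : Prop :=
  ∃ C l, c.1 = some C ∧ (l, c'.1) ∈ C.next ∧ l.Ok J c.2.1 ∧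
    (∀ x, c'.2.1 x = (l.tm x).eval J c.2.1) ∧ ∀ y A, c'.2.2 y A = c.2.2 y A + l.cnt y A

/-- Executions project to abstract configurations. The initial counts `K` are arbitrary so that the
induction can carry the increments already made. -/
theorem exists_aStep_of_step {r : Option (Prog S)} {w w' : World S}
    (h : Relation.ReflTransGen (Step J) (Conf.mk r w) (.done w')) (K : S.Obs → S.Test → ℕ) :
    ∃ ls, Exec J ls w w' ∧ Relation.ReflTransGen (AStep J) (r, w.obs, K)
      (none, w'.obs, fun y A => K y A + cnts ls y A) := by
  generalize hc : Conf.mk r w = c at h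
  induction h using Relation.ReflTransGen.head_induction_on generalizing r w K with
  | refl =>
    cases r with
    | some C => cases hc
    | none =>
      injection hc with hc
      subst hc
      exact ⟨[], rfl, .refl⟩
  | @head c d h _ ih =>
    subst hc
    cases r with
    | none => exact (Step.not_done h).elim
    | some C =>
      obtain ⟨l, r, w₁, hm, hs, rfl⟩ := Step.run_iff.1 h
      obtain ⟨ls, he, hr⟩ := ih (fun y A => K y A + l.cnt y A) rfl
      have hstep : AStep J (some C, w.obs, K) (r, w₁.obs, fun y A => K y A + l.cnt y A) :=
        ⟨C, l, rfl, hm, hs.spec.1, hs.spec.2.1, fun _ _ => rfl⟩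
      refine ⟨l :: ls, ⟨w₁, hs, he⟩, .head hstep ?_⟩
      convert hr using 4
      simp [cnts, add_assoc]

/-- Abstract steps lift to worlds because executability and the new observable values depend only on
the old observable values. -/
theorem exists_step_of_aStep {r : Option (Prog S)} {w : World S} {K : S.Obs → S.Test → ℕ}
    {c : AConf S} (h : Relation.ReflTransGen (AStep J) (r, w.obs, K) c) (hc : c.1 = none) :
    ∃ ls w', Exec J ls w w' ∧ Relation.ReflTransGen (Step J) (Conf.mk r w) (.done w') ∧
      c.2.1 = w'.obs ∧ ∀ y A, c.2.2 y A = K y A + cnts ls y A := by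
  generalize hd : (r, w.obs, K) = d at h
  induction h using Relation.ReflTransGen.head_induction_on generalizing r w K with
  | refl =>
    subst hd
    obtain rfl : r = none := hc
    exact ⟨[], w, rfl, .refl, rfl, fun _ _ => rfl⟩
  | @head c' d h _ ih =>
    subst hd
    obtain ⟨C, l, hr, hm, hok, hX, hK⟩ := h
    obtain rfl : r = some C := hr
    obtain ⟨w₁, hs⟩ := Lbl.exists_step hok
    have hd : (d.1, w₁.obs, d.2.2) = d := by
      rw [show w₁.obs = d.2.1 from funext fun x => by rw [hX, hs.spec.2.1]]
    obtain ⟨ls, w', he, hr, hw', hK'⟩ := ih hd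
    refine ⟨l :: ls, w', ⟨w₁, hs, he⟩, .head (Step.of_next C hm hs) hr, hw', fun y A => ?_⟩
    rw [hK', hK]
    simp [cnts, add_assoc]

/-! ## Coding of abstract configurations by tuples -/

variable (S) in
/-- The components of the code of an abstract configuration. -/
abbrev CodeIdx : Type := Option (S.Obs ⊕ S.Obs × S.Test)

/-- The value coded by a tuple. -/
def decodeVal (J : Interp S) (δ : Term S (Option S.Obs)) (x : S.Obs → Val S) (t : List ℤ) :
    Val S :=
  δ.eval J fun z => z.elim (some (ofTuple t)) x

/-- The abstract configuration coded by a family of tuples; `L` lists the residual programs. -/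
def decode (J : Interp S) (L : List (Prog S)) (δ : Term S (Option S.Obs)) (x : S.Obs → Val S)
    (a : CodeIdx S → List ℤ) : AConf S :=
  (L[(a none).length]?, fun v => decodeVal J δ x (a (some (.inl v))),
    fun y A => (a (some (.inr (y, A)))).length)

theorem TDfn.decodeVal {V : Type} (δ : Term S (Option S.Obs)) (v : V) :
    TDfn J V fun x a => decodeVal J δ x (a v) := by
  obtain ⟨u, hu⟩ := TDfn.eval (J := J) (V := V) δ
    (f := fun z x a => z.elim (some (ofTuple (a v))) x) (by
      rintro (_ | y)
      · exact TDfn.tuple v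
      · exact TDfn.obs y)
  exact ⟨u, hu⟩

/-- Bounds the quantifiers over programs and labels by the finite lists `L` and `C.next`, which
turns them into finite disjunctions. -/
theorem aStep_decode_iff {L : List (Prog S)} {δ : Term S (Option S.Obs)} {x : S.Obs → Val S}
    {a b : CodeIdx S → List ℤ} : AStep J (decode J L δ x a) (decode J L δ x b) ↔
      ∃ C ∈ L, ∃ p ∈ C.next, L[(a none).length]? = some C ∧ L[(b none).length]? = p.2 ∧
        (∃ o, p.1.lhs.eval J (fun v => decodeVal J δ x (a (some (.inl v)))) = some o ∧
          p.1.rhs.eval J (fun v => decodeVal J δ x (a (some (.inl v)))) = some o) ∧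
        (∀ v, decodeVal J δ x (b (some (.inl v))) =
          (p.1.tm v).eval J fun v => decodeVal J δ x (a (some (.inl v)))) ∧
        ∀ y A, (b (some (.inr (y, A)))).length =
          (a (some (.inr (y, A)))).length + p.1.cnt y A := by
  constructor
  · rintro ⟨C, l, h₁, h₂, h₃, h₄, h₅⟩
    exact ⟨C, List.mem_of_getElem? h₁, _, h₂, h₁, rfl, h₃, h₄, h₅⟩
  · rintro ⟨C, -, ⟨l, r⟩, h₂, h₁, rfl, h₃, h₄, h₅⟩
    exact ⟨C, l, h₁, h₂, h₃, h₄, h₅⟩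

theorem Dfn.aStep_decode (L : List (Prog S)) (δ : Term S (Option S.Obs)) :
    Dfn J (CodeIdx S ⊕ CodeIdx S) fun x a =>
      AStep J (decode J L δ x fun i => a (.inl i)) (decode J L δ x fun i => a (.inr i)) := by
  refine Dfn.congr ?_ fun x a => aStep_decode_iff
  refine exists_mem _ fun C => exists_mem _ fun p => ?_
  refine (getElem?_length_eq L _ (Sum.inl none)).and
    ((getElem?_length_eq L _ (Sum.inr none)).and (and ?_ (and ?_ ?_)))
  · exact eq_some (TDfn.eval _ fun v => TDfn.decodeVal δ (Sum.inl (some (Sum.inl v))))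
      (TDfn.eval _ fun v => TDfn.decodeVal δ (Sum.inl (some (Sum.inl v))))
  · exact forall_finite fun v => eq (TDfn.decodeVal δ (Sum.inr (some (Sum.inl v))))
      (TDfn.eval _ fun v => TDfn.decodeVal δ (Sum.inl (some (Sum.inl v))))
  · exact forall_finite fun y => forall_finite fun A =>
      length_eq_add (Sum.inr (some (Sum.inr (y, A)))) (Sum.inl (some (Sum.inr (y, A)))) _

/-- `b` codes a final configuration that is reachable from the program `C`. -/
def ReachCode (J : Interp S) (L : List (Prog S)) (δ : Term S (Option S.Obs)) (C : Prog S)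
    (x : S.Obs → Val S) (b : CodeIdx S → List ℤ) : Prop :=
  ∃ a : CodeIdx S → List ℤ, (L[(a none).length]? = some C ∧
    (∀ v, decodeVal J δ x (a (some (.inl v))) = x v) ∧
    ∀ y A, (a (some (.inr (y, A)))).length = 0) ∧
    Relation.ReflTransGen (fun a b => AStep J (decode J L δ x a) (decode J L δ x b)) a b ∧
    L[(b none).length]? = none

theorem Dfn.reachCode (L : List (Prog S)) (δ : Term S (Option S.Obs)) (C : Prog S) :
    Dfn J (CodeIdx S) fun x b => ReachCode J L δ C x b := by
  refine exists_family (and (and ?_ (and ?_ ?_)) (and ?_ ?_))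
  · exact getElem?_length_eq L _ (Sum.inl none)
  · exact forall_finite fun v =>
      eq (TDfn.decodeVal δ (Sum.inl (some (Sum.inl v)))) (TDfn.obs v)
  · exact forall_finite fun y => forall_finite fun A =>
      length_eq (Sum.inl (some (Sum.inr (y, A)))) 0
  · exact reflTransGen (Q := fun x a b => AStep J (decode J L δ x a) (decode J L δ x b))
      (aStep_decode L δ)
  · exact getElem?_length_eq L _ (Sum.inr none)

/-! ### Existence of codes, and weakest preconditions of programs with loops -/

theorem Gen.eval {T : Set (Sym S)} {x X : S.Obs → Val S} (hX : ∀ v, Gen J T x (X v))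
    (e : PTerm S) (he : e.syms ⊆ T) : Gen J T x (e.eval J X) := by
  induction e with
  | var v => exact hX v
  | app f args ih =>
    refine .app f (he (.inl rfl)) _ fun j => ih j (subset_trans ?_ he)
    exact (Set.subset_iUnion (fun j => (args j).syms) j).trans Set.subset_union_right

theorem Lbl.syms_tm_subset (l : Lbl S) (x : S.Obs) : (l.tm x).syms ⊆ l.syms := by
  classical
  cases l with
  | guard e b => exact Set.empty_subset _
  | cmd c =>
    cases c with
    | skip => exact Set.empty_subset _
    | assign v e =>
      rw [tm, Function.update_apply]
      split_ifs
      · exact subset_rfl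
      · exact Set.empty_subset _

section Encodable

variable {L : List (Prog S)} {δ : Term S (Option S.Obs)} {T : Set (Sym S)}
  {x : S.Obs → Val S}

theorem exists_decode_eq (hδ : ∀ o, Gen J T x o → ∃ t, decodeVal J δ x t = o) {c : AConf S}
    (hL : ∀ C ∈ c.1, C ∈ L) (hX : ∀ v, Gen J T x (c.2.1 v)) : ∃ a, decode J L δ x a = c := by
  obtain ⟨n, hn⟩ : ∃ n : ℕ, L[n]? = c.1 := by
    rcases hc : c.1 with _ | C
    -- A finished program is coded by an index past the end of `L`.
    · exact ⟨L.length, List.getElem?_eq_none le_rfl⟩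
    · exact List.mem_iff_getElem?.1 (hL C hc)
  choose t ht using fun v => hδ _ (hX v)
  refine ⟨fun i => i.elim (List.replicate n 0)
    (Sum.elim t fun p => List.replicate (c.2.2 p.1 p.2) 0), ?_⟩
  refine Prod.ext ?_ (Prod.ext (funext ht) ?_)
  · simpa [decode] using hn
  · funext y A
    simp [decode]

/-- Not only the final configuration but every intermediate one needs a code. It has one because its
observable values are generated from the initial values `x`, which stay the parameters of `δ`
throughout. -/
theorem exists_code_of_aStep (hδ : ∀ o, Gen J T x o → ∃ t, decodeVal J δ x t = o)
    (hclosed : ∀ C ∈ L, ∀ l C', (l, some C') ∈ C.next → C' ∈ L) {c c' : AConf S}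
    (h : Relation.ReflTransGen (AStep J) c c') {a : CodeIdx S → List ℤ}
    (ha : decode J L δ x a = c) (hL : ∀ C ∈ c.1, C ∈ L ∧ C.syms ⊆ T)
    (hX : ∀ v, Gen J T x (c.2.1 v)) :
    ∃ b, decode J L δ x b = c' ∧
      Relation.ReflTransGen (fun a b => AStep J (decode J L δ x a) (decode J L δ x b)) a b := by
  induction h using Relation.ReflTransGen.head_induction_on generalizing a with
  | refl => exact ⟨a, ha, .refl⟩
  | @head c d h _ ih =>
    obtain ⟨C, l, hC, hm, -, hval, -⟩ := id h
    obtain ⟨hCL, hCT⟩ := hL C hC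
    obtain ⟨hs, hs'⟩ := C.syms_of_mem_next hm
    have hL' : ∀ C' ∈ d.1, C' ∈ L ∧ C'.syms ⊆ T := fun C' hC' => by
      refine ⟨hclosed C hCL l C' ?_, (hs' C' hC').trans hCT⟩
      rwa [← show d.1 = some C' from hC']
    have hX' : ∀ v, Gen J T x (d.2.1 v) := fun v => by
      rw [hval]
      exact Gen.eval hX _ ((l.syms_tm_subset v).trans (hs.trans hCT))
    obtain ⟨a', ha'⟩ := exists_decode_eq hδ (fun C hC => (hL' C hC).1) hX'
    obtain ⟨b, hb, hr⟩ := ih ha' hL' hX'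
    exact ⟨b, hb, .head (by rwa [ha, ha']) hr⟩

end Encodable

theorem Prog.mem_sem_iff_reflTransGen {C : Prog S} {w w' : World S} :
    w' ∈ C.sem J w ↔ Relation.ReflTransGen (Step J) (Conf.mk (some C) w) (.done w') := by
  rw [Relation.reflTransGen_iff_eq_or_transGen]
  exact ⟨.inr, fun h => h.resolve_left (by rintro ⟨⟩)⟩

/-- Weakest preconditions with respect to programs whose data are encodable. -/
theorem Fml.exists_wp_of_encodable (φ : Fml S) (C : Prog S) (hC : C.Encodable J) :
    ∃ F : Fml S, ∀ (M : Model J) ι, ∀ w ∈ M.worlds,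
      (M.sat ι w F ↔ ∀ w' ∈ C.sem J w, M.sat ι w' φ) := by
  obtain ⟨δ, hδ⟩ := hC
  obtain ⟨R, hfin, hCR, hclosed⟩ := C.exists_residuals
  obtain ⟨L, hL⟩ : ∃ L : List (Prog S), ∀ C, C ∈ L ↔ C ∈ R := ⟨hfin.toFinset.toList, by simp⟩
  simp only [← hL] at hCR hclosed
  obtain ⟨N, hN⟩ := φ.exists_subst J
  obtain ⟨h, hh, hhN⟩ := exists_injective_ge (CodeIdx S) N
  obtain ⟨E, hE⟩ := Dfn.reachCode (J := J) L δ C h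
  -- Observable variables are read off the code by `δ` at the initial values; history variables grow
  -- by the length of their component. The integer variables used lie from `N` upwards, as capture
  -- avoidance requires.
  obtain ⟨φ', hφ'⟩ := hN
    (fun
      | .obs x => δ.bind fun z => z.elim (.var (.inr (h (some (.inl x))))) fun y =>
          .var (.inl (.obs y))
      | .inv z => .var (.inl (.inv z))
      | .hist y A => tAdd (.var (.inl (.hist y A)))
          (tLen (.var (.inr (h (some (.inr (y, A)))))))) (by
    intro z m ι ι' hι
    cases z with
    | obs x =>
      simp only [evalA, Term.eval_bind]
      congr 1
      funext z
      cases z with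
      | none => simp [hι _ (hhN _)]
      | some y => rfl
    | inv z => rfl
    | hist y A => simp [evalA, hι _ (hhN _)])
  obtain ⟨F, hF⟩ := Fml.exists_forall_extend hh (.neg (.and E (.neg φ')))
  refine ⟨F, fun M ι w hw => (hF M ι w).trans ?_⟩
  have hext : ∀ s : CodeIdx S → List ℤ, (fun v => Function.extend h s ι (h v)) = s :=
    fun s => funext fun i => hh.extend_apply _ _ i
  simp only [Model.sat, not_and, not_not, hE M _ w hw, hext]
  -- If `s` codes the result of an execution, the substitution describes it in all indistinguishable
  -- worlds, because `δ` receives only tuples and observable values.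
  have key : ∀ (s : CodeIdx S → List ℤ) (ls : List (Lbl S)) (w' : World S), Exec J ls w w' →
      (decode J L δ w.obs s).2.1 = w'.obs →
      (∀ y A, (decode J L δ w.obs s).2.2 y A = cnts ls y A) →
      (M.sat (Function.extend h s ι) w φ' ↔ M.sat ι w' φ) := by
    intro s ls w' he hX hK
    refine hφ' M _ ι w w' (fun i hi => Function.extend_apply' _ _ _ ?_)
      (Model.simulates_of_exec he hw (fun u hu x => ?_) (fun _ => rfl) fun y A m => ?_)
    · rintro ⟨j, rfl⟩
      exact absurd (hhN j) (Nat.not_le_of_lt hi)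
    · rw [← hX, evalA, Term.eval_bind]
      change _ = δ.eval J _
      congr 1
      funext z
      cases z with
      | none =>
        change some (ofTuple (Function.extend h s ι (h _))) = _
        rw [hh.extend_apply]
        rfl
      | some y => exact congrFun hu y
    · rw [← hK]
      simp [evalA, hh.extend_apply, lenVal, ofTuple, decode]
  constructor
  · intro H w' hw'
    obtain ⟨ls, he, hr⟩ := exists_aStep_of_step (Prog.mem_sem_iff_reflTransGen.1 hw') fun _ _ => 0
    have hδ' : ∀ o, Gen J C.syms w.obs o → ∃ t, decodeVal J δ w.obs t = o := hδ w.obs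
    obtain ⟨a, ha⟩ := exists_decode_eq (L := L) (c := (some C, w.obs, fun _ _ => 0)) hδ'
      (by rintro _ ⟨⟩; exact hCR) fun v => .var v
    obtain ⟨b, hb, hab⟩ := exists_code_of_aStep hδ' hclosed hr ha
      (by rintro _ ⟨⟩; exact ⟨hCR, subset_rfl⟩) fun v => .var v
    refine (key b ls w' he (by rw [hb]) (by simp [hb])).1 (H b ⟨a, ⟨?_, ?_, ?_⟩, hab, ?_⟩)
    · exact congrArg Prod.fst ha
    · exact fun v => congrFun (congrArg (fun c : AConf S => c.2.1) ha) v
    · exact fun y A => congrFun (congrFun (congrArg (fun c : AConf S => c.2.2) ha) y) A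
    · exact congrArg Prod.fst hb
  · rintro H b ⟨a, ⟨h₁, h₂, h₃⟩, hab, hb⟩
    have ha : decode J L δ w.obs a = (some C, w.obs, fun _ _ => 0) :=
      Prod.ext h₁ (Prod.ext (funext h₂) (funext fun y => funext fun A => h₃ y A))
    have hr : Relation.ReflTransGen (AStep J) (decode J L δ w.obs a) (decode J L δ w.obs b) :=
      hab.lift _ fun _ _ => id
    rw [ha] at hr
    obtain ⟨ls, w', he, hs, hX, hK⟩ := exists_step_of_aStep hr hb
    exact (key b ls w' he hX (by simpa using hK)).2 (H w' (Prog.mem_sem_iff_reflTransGen.2 hs))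

end BHL

end

theorem mainTheorem3 (S : BHL.Vocab) (J : BHL.Interp S) (C : BHL.Prog S) (hC : C.WF)
    (hloop : C.HasLoop → C.Encodable J) (φ : BHL.Fml S) :
    ∃ F : BHL.Fml S, ∀ (M : BHL.Model J) (ι : BHL.IntVar → List ℤ),
      M.ext ι F = M.wp ι C φ := by
  obtain ⟨F, hF⟩ : ∃ F : BHL.Fml S, ∀ (M : BHL.Model J) ι, ∀ w ∈ M.worlds,
      (M.sat ι w F ↔ ∀ w' ∈ C.sem J w, M.sat ι w' φ) := by
    by_cases h : C.HasLoop
    · exact BHL.Fml.exists_wp_of_encodable φ C (hloop h)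
    · exact BHL.Fml.exists_wp_of_not_hasLoop J φ C h
  exact ⟨F, fun M ι => Set.ext fun w => and_congr_right fun hw => hF M ι w hw⟩
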